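/- Let $n\ge 1$, $s\in(0,1)$, $p>1$, $\Lambda\ge 1$, and let $K:\mathbb R^n\times\mathbb R^n\to[0,\infty)$ be measurable and symmetric, $K(x,y)=K(y,x)$, with $$\Lambda^{-1}\le K(x,y)\,|x-y|^{n+sp}\le\Lambda\qquad\text{for a.e. }x,y\in\mathbb R^n .$$ Write $L(a,b)=|a-b|^{p-2}(a-b)$, with $L(a,a)=0$. For an open set $D\subset\mathbb R^n$, $W^{s,p}(D)$ is the set of $u\in L^p(D)$ with $\int_D\int_D |u(x)-u(y)|^p|x-y|^{-n-sp}\,dx\,dy<\infty$, and $u\in W^{s,p}_{\rm loc}(D)$ means $u\in W^{s,p}(D_0)$ for every open $D_0\Subset D$ (that is, $\overline{D_0}$ is compact and contained in $D$). The tail space $L^{p-1}_{sp}(\mathbb R^n)$ is the set of $f\in L^{p-1}_{\rm loc}(\mathbb R^n)$ with $\int_{\mathbb R^n\setminus B_r(z)}|f(x)|^{p-1}|x-z|^{-n-sp}\,dx<\infty$ for all $z\in\mathbb R^n$ and $r>0$. Let $\Omega\Subset\Omega'$ be bounded open subsets of $\mathbb R^n$, let $h:\mathbb R^n\to[-\infty,\infty)$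 be any function (the obstacle), and let $g\in W^{s,p}(\Omega')\cap L^{p-1}_{sp}(\mathbb R^n)$ be real-valued on $\mathbb R^n$ (the boundary values). Let $$\mathcal K_{g,h}(\Omega,\Omega')=\{u:\mathbb R^n\to\mathbb R \;:\; u\in W^{s,p}(\Omega'),\ u\ge h\text{ a.e. in }\Omega,\ u=g\text{ a.e. on }\mathbb R^n\setminus\Omega\},$$ and, for $u\in\mathcal K_{g,h}(\Omega,\Omega')$ and $v\in W^{s,p}(\Omega')$, $$\mathcal Au(v)=\int_{\Omega'}\int_{\Omega'}L(u(x),u(y))\,(v(x)-v(y))\,K(x,y)\,dx\,dy+2\int_{\mathbb R^n\setminus\Omega'}\int_{\Omega}L(u(x),g(y))\,v(x)\,K(x,y)\,dx\,dy .$$ A solution to the obstacle problem in $\mathcal K_{g,h}(\Omega,\Omega')$ is a function $u\in\mathcal K_{g,h}(\Omega,\Omega')$ such that $\mathcal Au(v-u)\ge 0$ for all $v\in\mathcal K_{g,h}(\Omega,\Omega')$. **Theorem.** Suppose that $\mathcal K_{g,h}(\Omega,\Omega')\neq\emptyset$. Then there exists a solution to the obstacle problem in $\mathcal K_{g,h}(\Omega,\Omega')$,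 and it is unique up to equality almost everywhere in $\mathbb R^n$. Moreover, the solution $u$ is a weak supersolution in $\Omega$ of $\int_{\mathbb R^n}K(x,y)|u(x)-u(y)|^{p-2}(u(x)-u(y))\,dy=0$; that is, $u\in W^{s,p}_{\rm loc}(\Omega)\cap L^{p-1}_{sp}(\mathbb R^n)$ and, for every nonnegative $\eta\in C_0^\infty(\Omega)$, the following integral converges absolutely and satisfies $$\int_{\mathbb R^n}\int_{\mathbb R^n}L(u(x),u(y))\,(\eta(x)-\eta(y))\,K(x,y)\,dx\,dy\ \ge\ 0 .$$ -/

import Mathlib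

open MeasureTheory
open scoped ENNReal ContDiff

noncomputable section

namespace FracObstacle

/-- The Euclidean space `ℝⁿ`. -/
abbrev E (n : ℕ) : Type := EuclideanSpace ℝ (Fin n)

/-- `D ⋐ Ω`: the closure of `D` is compact and contained in `Ω`. -/
def CompactlyContained {n : ℕ} (D Ω : Set (E n)) : Prop :=
  IsCompact (closure D) ∧ closure D ⊆ Ω

/-- The `p`-th power of the Gagliardo seminorm on `Ω`,
`∫_Ω ∫_Ω |u(x) - u(y)|^p / |x - y|^(n + s p) dx dy`, with values in `[0, ∞]`. -/
def gagliardoEnergy {n : ℕ} (s p : ℝ) (Ω : Set (E n)) (u : E n → ℝ) : ℝ≥0∞ :=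
  ∫⁻ z in Ω ×ˢ Ω, ENNReal.ofReal (|u z.1 - u z.2| ^ p / ‖z.1 - z.2‖ ^ ((n : ℝ) + s * p))

/-- `u ∈ W^{s,p}(Ω)`: `u` is (Lebesgue) measurable on `Ω`, lies in `L^p(Ω)`, and has a finite
Gagliardo seminorm on `Ω`. -/
def MemW {n : ℕ} (s p : ℝ) (Ω : Set (E n)) (u : E n → ℝ) : Prop :=
  MemLp u (ENNReal.ofReal p) (volume.restrict Ω) ∧ gagliardoEnergy s p Ω u < ⊤

/-- `u ∈ W^{s,p}_loc(Ω)`: `u ∈ W^{s,p}(D)` for every open `D ⋐ Ω`. -/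
def MemWLoc {n : ℕ} (s p : ℝ) (Ω : Set (E n)) (u : E n → ℝ) : Prop :=
  ∀ D : Set (E n), IsOpen D → CompactlyContained D Ω → MemW s p D u

/-- The nonlocal tail
`Tail(f; z, r) = (r^(sp) ∫_{ℝⁿ ∖ B_r(z)} |f(x)|^(p-1) |x - z|^(-n-sp) dx)^(1/(p-1))`,
with values in `[0, ∞]`. -/
def tail {n : ℕ} (s p : ℝ) (f : E n → ℝ) (z : E n) (r : ℝ) : ℝ≥0∞ :=
  (ENNReal.ofReal (r ^ (s * p)) *
    ∫⁻ x in (Metric.ball z r)ᶜ,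
      ENNReal.ofReal (|f x| ^ (p - 1) * ‖x - z‖ ^ (-(n : ℝ) - s * p))) ^ (1 / (p - 1))

/-- `f ∈ L^{p-1}_{sp}(ℝⁿ)`: `f ∈ L^{p-1}_loc(ℝⁿ)` and all the tails of `f` are finite. -/
def MemTailSpace {n : ℕ} (s p : ℝ) (f : E n → ℝ) : Prop :=
  (∀ C : Set (E n), IsCompact C → MemLp f (ENNReal.ofReal (p - 1)) (volume.restrict C)) ∧
    ∀ (z : E n) (r : ℝ), 0 < r → tail s p f z r < ⊤

/-- `K : ℝⁿ × ℝⁿ → [0, ∞)` is a measurable symmetric kernel of order `(s, p)` with ellipticity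
constant `Λ`. -/
structure IsKernel {n : ℕ} (s p Λ : ℝ) (K : E n → E n → ℝ) : Prop where
  aemeasurable : AEMeasurable (fun z : E n × E n => K z.1 z.2) volume
  nonneg : ∀ x y, 0 ≤ K x y
  symm : ∀ x y, K x y = K y x
  bounds : ∀ᵐ z : E n × E n,
    Λ⁻¹ ≤ K z.1 z.2 * ‖z.1 - z.2‖ ^ ((n : ℝ) + s * p) ∧
      K z.1 z.2 * ‖z.1 - z.2‖ ^ ((n : ℝ) + s * p) ≤ Λ

/-- `L(a, b) = |a - b|^(p-2) (a - b)`; it is `0` for `a = b`. -/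
def L (p a b : ℝ) : ℝ := |a - b| ^ (p - 2) * (a - b)

/-- The integrand of the weak form `⟨ℒu, η⟩`. -/
def weakIntegrand {n : ℕ} (p : ℝ) (K : E n → E n → ℝ) (u η : E n → ℝ) (z : E n × E n) : ℝ :=
  L p (u z.1) (u z.2) * (η z.1 - η z.2) * K z.1 z.2

/-- `u` is a weak supersolution in `Ω` of
`∫ K(x,y) |u(x) - u(y)|^(p-2) (u(x) - u(y)) dy = 0`: it lies in
`W^{s,p}_loc(Ω) ∩ L^{p-1}_{sp}(ℝⁿ)`, and for every nonnegative `η ∈ C_0^∞(Ω)` the double integral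
`⟨ℒu, η⟩` converges absolutely and is nonnegative. -/
def IsWeakSupersolution {n : ℕ} (s p : ℝ) (K : E n → E n → ℝ) (Ω : Set (E n))
    (u : E n → ℝ) : Prop :=
  MemWLoc s p Ω u ∧ MemTailSpace s p u ∧
    ∀ η : E n → ℝ, ContDiff ℝ ∞ η → HasCompactSupport η → tsupport η ⊆ Ω → (∀ x, 0 ≤ η x) →
      Integrable (weakIntegrand p K u η) ∧ 0 ≤ ∫ z, weakIntegrand p K u η z

/-- The class `𝒦_{g,h}(Ω, Ω')` of the functions `u ∈ W^{s,p}(Ω')` with `u ≥ h` a.e. in `Ω` and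
`u = g` a.e. on `ℝⁿ ∖ Ω`. -/
def obstacleClass {n : ℕ} (s p : ℝ) (g : E n → ℝ) (h : E n → EReal) (Ω Ω' : Set (E n)) :
    Set (E n → ℝ) :=
  {u | MemW s p Ω' u ∧ (∀ᵐ x ∂(volume.restrict Ω), h x ≤ (u x : EReal)) ∧
    ∀ᵐ x ∂(volume.restrict Ωᶜ), u x = g x}

/-- `𝒜₁u(v)`, the double integral over `Ω' × Ω'`. -/
def A₁ {n : ℕ} (p : ℝ) (K : E n → E n → ℝ) (Ω' : Set (E n)) (u v : E n → ℝ) : ℝ :=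
  ∫ z in Ω' ×ˢ Ω', L p (u z.1) (u z.2) * (v z.1 - v z.2) * K z.1 z.2

/-- `𝒜₂u(v)`, twice the double integral over `x ∈ Ω`, `y ∈ ℝⁿ ∖ Ω'`. -/
def A₂ {n : ℕ} (p : ℝ) (K : E n → E n → ℝ) (g : E n → ℝ) (Ω Ω' : Set (E n))
    (u v : E n → ℝ) : ℝ :=
  2 * ∫ z in Ω ×ˢ Ω'ᶜ, L p (u z.1) (g z.2) * v z.1 * K z.1 z.2

/-- `𝒜u(v) = 𝒜₁u(v) + 𝒜₂u(v)`. -/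
def A {n : ℕ} (p : ℝ) (K : E n → E n → ℝ) (g : E n → ℝ) (Ω Ω' : Set (E n))
    (u v : E n → ℝ) : ℝ :=
  A₁ p K Ω' u v + A₂ p K g Ω Ω' u v

/-- `u` is a solution to the obstacle problem in `𝒦_{g,h}(Ω, Ω')`: it lies in that class and
`𝒜u(v - u) ≥ 0` for every `v` in the class. -/
def IsObstacleSolution {n : ℕ} (s p : ℝ) (K : E n → E n → ℝ) (g : E n → ℝ) (h : E n → EReal)
    (Ω Ω' : Set (E n)) (u : E n → ℝ) : Prop :=
  u ∈ obstacleClass s p g h Ω Ω' ∧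
    ∀ v ∈ obstacleClass s p g h Ω Ω', 0 ≤ A p K g Ω Ω' u (v - u)

end FracObstacle

end

noncomputable section

namespace FracObstacle

open Filter Topology

/-! ### Scalar inequalities for `|t| ^ p` -/

/-! Write Du(x,y) = u(x) - u(y), let μ be the measure K(x,y) dx dy, and let ν be its restriction to
Ω' × Ω'. If u and v are in the class, v - u vanishes off Ω, so symmetry of K turns 𝒜u(v - u) into ∫
|Du|^(p-2) Du (Dv - Du) dμ. This is, up to the factor p, the derivative of the convex energy ∫
|Du|^p dμ, and a solution is a minimiser of that energy.

Outside Ω' the data g has only a finite tail of power p - 1, so the energy itself may be infinite.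
It is replaced by the relative energy ∫ (|Dv|^p - |Du|^p) dμ, which is finite because the integrand
is bounded by a multiple of |Du|^(p-1) |Dv - Du| + |Dv - Du|^p. Three estimates for w vanishing off
Ω control these terms by the L^p(ν) norm of Dw: the Poincaré inequality `exists_poincare`, and the
passages from ν to μ in `exists_lintegral_rpow_le` and `exists_lintegral_dual_le`. The far
interaction is handled by a weight that depends on y alone.

Existence needs no weak compactness. The relative energy is coercive, and uniform convexity of |t|^p
(`abs_sub_rpow_le_midDefect`) makes minimising sequences Cauchy in L^p(ν). By Poincaré their limits
stay in the class, and the first variation at the minimiser is the required inequality.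
`EnergyClass` isolates what this argument uses. Uniqueness is strict monotonicity of t ↦ |t|^(p-2) t
followed by Poincaré. The supersolution property comes from the competitor u + η, where η ∈
W^{s,p}(Ω') because it is Lipschitz and p - sp > 0. -/

/-- The odd power `|t|^(p-2) t`, which is `1/p` times the derivative of `|t|^p`. -/
def oddPow (p t : ℝ) : ℝ := |t| ^ (p - 2) * t

theorem oddPow_neg (p t : ℝ) : oddPow p (-t) = -oddPow p t := by simp [oddPow]

theorem abs_oddPow {p : ℝ} (hp : 1 < p) (t : ℝ) : |oddPow p t| = |t| ^ (p - 1) := by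
  unfold oddPow
  rcases eq_or_ne t 0 with rfl | ht
  · simp [Real.zero_rpow (sub_ne_zero.2 hp.ne')]
  · rw [abs_mul, abs_of_nonneg (Real.rpow_nonneg (abs_nonneg t) _),
      ← Real.rpow_add_one (abs_pos.2 ht).ne']
    congr 1; ring

theorem measurable_oddPow (p : ℝ) : Measurable (oddPow p) := by
  unfold oddPow; fun_prop

theorem hasDerivAt_abs_rpow_oddPow {p : ℝ} (hp : 1 < p) (t : ℝ) :
    HasDerivAt (fun x : ℝ => |x| ^ p) (p * oddPow p t) t := by
  have := hasDerivAt_abs_rpow t hp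
  rwa [mul_assoc] at this

theorem convexOn_abs_rpow {p : ℝ} (hp : 1 < p) : ConvexOn ℝ Set.univ (fun x : ℝ => |x| ^ p) := by
  have h1 : ConvexOn ℝ (Set.univ : Set ℝ) (fun x : ℝ => |x|) :=
    convexOn_norm convex_univ
  refine ⟨convex_univ, fun x _ y _ a b ha hb hab => ?_⟩
  have h2 := h1.2 (Set.mem_univ x) (Set.mem_univ y) ha hb hab
  have h3 := (convexOn_rpow hp.le).2 (abs_nonneg x) (abs_nonneg y) ha hb hab
  exact (Real.rpow_le_rpow (abs_nonneg _) h2 (by linarith)).trans h3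

theorem abs_rpow_add_tangent_le {p : ℝ} (hp : 1 < p) (a b : ℝ) :
    |a| ^ p + p * oddPow p a * b ≤ |a + b| ^ p := by
  have hc := convexOn_abs_rpow hp
  rcases lt_trichotomy b 0 with hb | rfl | hb
  · have h := hc.slope_le_of_hasDerivAt (Set.mem_univ (a + b)) (Set.mem_univ a) (by linarith)
      (hasDerivAt_abs_rpow_oddPow hp a)
    rw [slope_def_field, div_le_iff₀ (by linarith)] at h
    linarith
  · simp
  · have h := hc.le_slope_of_hasDerivAt (Set.mem_univ a) (Set.mem_univ (a + b)) (by linarith)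
      (hasDerivAt_abs_rpow_oddPow hp a)
    rw [slope_def_field, le_div_iff₀ (by linarith)] at h
    linarith

/-- The tangent inequality at `a` bounds the difference from below, and the one at `a + b` bounds it
from above. -/
theorem abs_abs_rpow_sub_le {p : ℝ} (hp : 1 < p) (a b : ℝ) :
    |(|a + b| ^ p - |a| ^ p)| ≤ p * |b| * (|a| + |b|) ^ (p - 1) := by
  have h1 := abs_rpow_add_tangent_le hp a b
  have h2 := abs_rpow_add_tangent_le hp (a + b) (-b)
  rw [add_neg_cancel_right] at h2
  have key : ∀ t, |t| ≤ |a| + |b| → |p * oddPow p t * b| ≤ p * |b| * (|a| + |b|) ^ (p - 1) := by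
    intro t ht
    rw [abs_mul, abs_mul, abs_oddPow hp, abs_of_pos (by linarith : 0 < p)]
    have : |t| ^ (p - 1) ≤ (|a| + |b|) ^ (p - 1) :=
      Real.rpow_le_rpow (abs_nonneg _) ht (by linarith)
    nlinarith [mul_le_mul_of_nonneg_left this (by positivity : 0 ≤ p * |b|)]
  have k1 := abs_le.1 (key a (by linarith [abs_nonneg b]))
  have k2 := abs_le.1 (key (a + b) (abs_add_le a b))
  rw [abs_le]
  constructor <;> linarith [k1.1, k2.2]

theorem add_rpow_le_two_rpow {q x y : ℝ} (hq : 0 ≤ q) (hx : 0 ≤ x) (hy : 0 ≤ y) :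
    (x + y) ^ q ≤ 2 ^ q * (x ^ q + y ^ q) := by
  have hx' := Real.rpow_nonneg hx q
  have hy' := Real.rpow_nonneg hy q
  have h2 : (0 : ℝ) ≤ 2 ^ q := by positivity
  rcases le_total x y with h | h
  · calc (x + y) ^ q ≤ (2 * y) ^ q := Real.rpow_le_rpow (by positivity) (by linarith) hq
      _ = 2 ^ q * y ^ q := Real.mul_rpow (by norm_num) hy
      _ ≤ _ := mul_le_mul_of_nonneg_left (by linarith) h2
  · calc (x + y) ^ q ≤ (2 * x) ^ q := Real.rpow_le_rpow (by positivity) (by linarith) hq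
      _ = 2 ^ q * x ^ q := Real.mul_rpow (by norm_num) hx
      _ ≤ _ := mul_le_mul_of_nonneg_left (by linarith) h2

theorem abs_sub_rpow_le {q : ℝ} (hq : 0 ≤ q) (a b : ℝ) :
    |a - b| ^ q ≤ 2 ^ q * (|a| ^ q + |b| ^ q) :=
  (Real.rpow_le_rpow (abs_nonneg _) (abs_sub a b) hq).trans
    (add_rpow_le_two_rpow hq (abs_nonneg _) (abs_nonneg _))

theorem rpow_sub_one_mul {p x : ℝ} (hp : 1 < p) (hx : 0 ≤ x) : x ^ (p - 1) * x = x ^ p := by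
  rcases hx.eq_or_lt with rfl | h
  · rw [mul_zero, Real.zero_rpow (by linarith)]
  · rw [← Real.rpow_add_one h.ne']; congr 1; ring

theorem abs_abs_rpow_sub_le' {p : ℝ} (hp : 1 < p) (a b : ℝ) :
    |(|a + b| ^ p - |a| ^ p)| ≤ p * 2 ^ (p - 1) * (|a| ^ (p - 1) * |b| + |b| ^ p) := by
  refine (abs_abs_rpow_sub_le hp a b).trans ?_
  have h := add_rpow_le_two_rpow (q := p - 1) (by linarith) (abs_nonneg a) (abs_nonneg b)
  have h3 := rpow_sub_one_mul hp (abs_nonneg b)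
  calc p * |b| * (|a| + |b|) ^ (p - 1)
      ≤ p * |b| * (2 ^ (p - 1) * (|a| ^ (p - 1) + |b| ^ (p - 1))) := by gcongr
    _ = p * 2 ^ (p - 1) * (|a| ^ (p - 1) * |b| + |b| ^ (p - 1) * |b|) := by ring
    _ = _ := by rw [h3]

/-- If |a| ≤ |b|, the quasi-triangle inequality gives the bound with loss 2|a|^p ≤ 2|a|^(p-1)|b|.
Otherwise |b|^p is itself at most |a|^(p-1)|b|, and the tangent inequality loses p such terms. The
constant p + 2 covers both regimes. -/
theorem rpow_coercive {p : ℝ} (hp : 1 < p) (a b : ℝ) :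
    2⁻¹ ^ p * |b| ^ p - (p + 2) * (|a| ^ (p - 1) * |b|) ≤ |a + b| ^ p - |a| ^ p := by
  have ha := abs_nonneg a
  have hb := abs_nonneg b
  have hh : (0 : ℝ) < 2⁻¹ ^ p := by positivity
  have hh1 : (2⁻¹ : ℝ) ^ p * 2 ^ p = 1 := by
    rw [← Real.mul_rpow (by norm_num) (by norm_num)]; norm_num
  have hle : (2⁻¹ : ℝ) ^ p ≤ 1 := Real.rpow_le_one (by norm_num) (by norm_num) (by linarith)
  have hm : 0 ≤ |a| ^ (p - 1) * |b| := by positivity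
  rcases le_total |a| |b| with h | h
  · have h1 := abs_sub_rpow_le (q := p) (by linarith) (a + b) a
    rw [add_sub_cancel_left] at h1
    have h2 : 2⁻¹ ^ p * |b| ^ p ≤ |a + b| ^ p + |a| ^ p := by
      calc 2⁻¹ ^ p * |b| ^ p ≤ 2⁻¹ ^ p * (2 ^ p * (|a + b| ^ p + |a| ^ p)) := by gcongr
        _ = _ := by rw [← mul_assoc, hh1, one_mul]
    have h3 : |a| ^ p ≤ |a| ^ (p - 1) * |b| := by
      rw [← rpow_sub_one_mul hp ha]; gcongr
    nlinarith
  · have h1 := abs_rpow_add_tangent_le hp a b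
    have h2 : |oddPow p a * b| = |a| ^ (p - 1) * |b| := by rw [abs_mul, abs_oddPow hp]
    have h3 := neg_abs_le (oddPow p a * b)
    rw [h2] at h3
    have h4 : |b| ^ p ≤ |a| ^ (p - 1) * |b| := by
      rw [← rpow_sub_one_mul hp hb]; gcongr
    have h5 : 2⁻¹ ^ p * |b| ^ p ≤ |a| ^ (p - 1) * |b| := by
      nlinarith [Real.rpow_nonneg hb p]
    nlinarith

/-! ### Uniform convexity of |t|^p. -/

/-- The midpoint convexity defect of `|t|^p`. -/
def midDefect (p a b : ℝ) : ℝ := (|a| ^ p + |b| ^ p) / 2 - |(a + b) / 2| ^ p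

/-- Strict convexity on [0, ∞) only separates distinct absolute values; the remaining case is a =
-b, where the midpoint is 0. -/
theorem midDefect_pos {p : ℝ} (hp : 1 < p) {a b : ℝ} (hab : a ≠ b) : 0 < midDefect p a b := by
  unfold midDefect
  rw [sub_pos]
  rcases eq_or_ne |a| |b| with h | h
  · have : a = -b := by
      rcases abs_eq_abs.1 h with h | h
      · exact absurd h hab
      · exact h
    subst this
    have hb : b ≠ 0 := by rintro rfl; simp at hab
    have : 0 < |b| ^ p := Real.rpow_pos_of_pos (abs_pos.2 hb) _
    simp only [neg_add_cancel, zero_div, abs_zero, abs_neg]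
    rw [Real.zero_rpow (by linarith)]
    linarith
  · have h2 := (strictConvexOn_rpow hp).2 (abs_nonneg a) (abs_nonneg b) h
      (by norm_num : (0 : ℝ) < 1 / 2) (by norm_num : (0 : ℝ) < 1 / 2) (by norm_num)
    simp only [smul_eq_mul] at h2
    have h3 : |(a + b) / 2| ≤ 1 / 2 * |a| + 1 / 2 * |b| := by
      rw [abs_div, abs_two]; linarith [abs_add_le a b]
    have h4 := Real.rpow_le_rpow (abs_nonneg _) h3 (by linarith : 0 ≤ p)
    linarith

theorem midDefect_nonneg {p : ℝ} (hp : 1 < p) (a b : ℝ) : 0 ≤ midDefect p a b := by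
  rcases eq_or_ne a b with rfl | h
  · simp [midDefect]
  · exact (midDefect_pos hp h).le

/-- Sum of the tangent inequalities at `a` and at `b`, both evaluated at the midpoint. It yields
strict monotonicity of `oddPow`. -/
theorem midDefect_le_oddPow {p : ℝ} (hp : 1 < p) (a b : ℝ) :
    4 * midDefect p a b ≤ p * ((oddPow p a - oddPow p b) * (a - b)) := by
  have h1 := abs_rpow_add_tangent_le hp a ((b - a) / 2)
  have h2 := abs_rpow_add_tangent_le hp b ((a - b) / 2)
  rw [show a + (b - a) / 2 = (a + b) / 2 by ring] at h1
  rw [show b + (a - b) / 2 = (a + b) / 2 by ring] at h2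
  unfold midDefect
  nlinarith

theorem oddPow_monotone_mul {p : ℝ} (hp : 1 < p) (a b : ℝ) :
    0 ≤ (oddPow p a - oddPow p b) * (a - b) := by
  have := midDefect_le_oddPow hp a b
  have h2 := midDefect_nonneg hp a b
  have : 0 ≤ p * ((oddPow p a - oddPow p b) * (a - b)) := by linarith
  exact nonneg_of_mul_nonneg_right this (by linarith)

theorem eq_of_oddPow_mul_eq_zero {p : ℝ} (hp : 1 < p) {a b : ℝ}
    (h : (oddPow p a - oddPow p b) * (a - b) = 0) : a = b := by
  by_contra hab
  have := midDefect_le_oddPow hp a b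
  have h2 := midDefect_pos hp hab
  rw [h] at this
  linarith

theorem midDefect_smul {p t : ℝ} (ht : 0 ≤ t) (a b : ℝ) :
    midDefect p (t * a) (t * b) = t ^ p * midDefect p a b := by
  unfold midDefect
  rw [show (t * a + t * b) / 2 = t * ((a + b) / 2) by ring, abs_mul, abs_mul, abs_mul,
    abs_of_nonneg ht, Real.mul_rpow ht (abs_nonneg _), Real.mul_rpow ht (abs_nonneg _),
    Real.mul_rpow ht (abs_nonneg _)]
  ring

/-- The defect is continuous and positive on a compact set that avoids the diagonal, so it has a
positive minimum there. -/
theorem exists_le_midDefect {p : ℝ} (hp : 1 < p) {ε : ℝ} (hε : 0 < ε) :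
    ∃ δ > 0, ∀ a b : ℝ, |a| ^ p + |b| ^ p = 1 → ε ≤ |a - b| ^ p → δ ≤ midDefect p a b := by
  have hp0 : 0 ≤ p := by linarith
  have c1 : Continuous fun z : ℝ × ℝ => |z.1| ^ p + |z.2| ^ p := by fun_prop (disch := assumption)
  have c2 : Continuous fun z : ℝ × ℝ => |z.1 - z.2| ^ p := by fun_prop (disch := assumption)
  have c3 : Continuous fun z : ℝ × ℝ => midDefect p z.1 z.2 := by
    unfold midDefect; fun_prop (disch := assumption)
  set S : Set (ℝ × ℝ) := {z | |z.1| ^ p + |z.2| ^ p = 1 ∧ ε ≤ |z.1 - z.2| ^ p}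
  have hS : IsCompact S := by
    refine (isCompact_Icc (a := ((-1, -1) : ℝ × ℝ)) (b := (1, 1))).of_isClosed_subset
      ((isClosed_eq c1 continuous_const).inter (isClosed_le continuous_const c2)) ?_
    rintro ⟨a, b⟩ ⟨h, -⟩
    have key : ∀ t : ℝ, |t| ^ p ≤ 1 → |t| ≤ 1 := fun t ht => by
      by_contra hc
      exact absurd ht (not_le.2 (Real.one_lt_rpow (not_le.1 hc) (by linarith)))
    simp only at h
    have ha := abs_le.1 (key a (by linarith [Real.rpow_nonneg (abs_nonneg b) p]))
    have hb := abs_le.1 (key b (by linarith [Real.rpow_nonneg (abs_nonneg a) p]))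
    exact ⟨⟨ha.1, hb.1⟩, ⟨ha.2, hb.2⟩⟩
  rcases S.eq_empty_or_nonempty with h | h
  · refine ⟨1, one_pos, fun a b h1 h2 => ?_⟩
    have : (a, b) ∈ S := ⟨h1, h2⟩
    simp [h] at this
  · obtain ⟨z, hz, hmin⟩ := hS.exists_isMinOn h c3.continuousOn
    refine ⟨midDefect p z.1 z.2, midDefect_pos hp ?_, fun a b h1 h2 => hmin (a := (a, b)) ⟨h1, h2⟩⟩
    intro hzz
    have := hz.2
    rw [hzz, sub_self, abs_zero, Real.zero_rpow (by linarith)] at this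
    linarith

/-- Uniform convexity of `|t|^p`, with an arbitrarily small error. -/
theorem abs_sub_rpow_le_midDefect {p : ℝ} (hp : 1 < p) {ε : ℝ} (hε : 0 < ε) :
    ∃ C, 0 ≤ C ∧ ∀ a b : ℝ,
      |a - b| ^ p ≤ C * midDefect p a b + ε * (|a| ^ p + |b| ^ p) := by
  -- The ε-term absorbs pairs that are close relative to their size, for which no bound by the
  -- defect alone holds when p < 2. All other pairs are scaled to the unit sphere by s^(-1/p), the
  -- defect being homogeneous of degree p.
  obtain ⟨δ, hδ, H⟩ := exists_le_midDefect hp hε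
  refine ⟨2 ^ p / δ, by positivity, fun a b => ?_⟩
  have hp0 : 0 < p := by linarith
  set s := |a| ^ p + |b| ^ p with hs
  have hs0 : 0 ≤ s := by positivity
  have hup : |a - b| ^ p ≤ 2 ^ p * s := abs_sub_rpow_le hp0.le a b
  have hC : 0 ≤ 2 ^ p / δ * midDefect p a b := mul_nonneg (by positivity) (midDefect_nonneg hp a b)
  by_cases hc : |a - b| ^ p ≤ ε * s
  · linarith
  rcases hs0.eq_or_lt with h0 | hpos
  · rw [← h0] at hup hc; linarith
  have ht : 0 ≤ (s⁻¹) ^ (1 / p) := by positivity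
  have htp : ((s⁻¹) ^ (1 / p)) ^ p = s⁻¹ := by
    rw [← Real.rpow_mul (by positivity), one_div_mul_cancel hp0.ne', Real.rpow_one]
  have hsc : ∀ c : ℝ, |(s⁻¹) ^ (1 / p) * c| ^ p = s⁻¹ * |c| ^ p := fun c => by
    rw [abs_mul, abs_of_nonneg ht, Real.mul_rpow ht (abs_nonneg _), htp]
  have h1 := H ((s⁻¹) ^ (1 / p) * a) ((s⁻¹) ^ (1 / p) * b)
    (by rw [hsc, hsc, ← mul_add, ← hs, inv_mul_cancel₀ hpos.ne'])
    (by rw [← mul_sub, hsc, inv_mul_eq_div, le_div_iff₀ hpos]; exact (not_le.1 hc).le)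
  rw [midDefect_smul ht, htp, inv_mul_eq_div, le_div_iff₀ hpos] at h1
  have : 2 ^ p * s ≤ 2 ^ p / δ * midDefect p a b := by
    rw [div_mul_eq_mul_div, le_div_iff₀ hδ]
    calc 2 ^ p * s * δ = 2 ^ p * (δ * s) := by ring
      _ ≤ _ := by gcongr
  have : 0 ≤ ε * s := by positivity
  linarith

theorem exists_rpow_sub_linear_ge {p : ℝ} (hp : 1 < p) {c : ℝ} (hc : 0 < c) (C : ℝ) :
    ∃ M, ∀ N : ℝ, 0 ≤ N → N - M ≤ c * N ^ p - C * N := by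
  -- Beyond some R one has c N^(p-1) ≥ C + 1; below R the linear term is bounded and goes into M.
  have hev := (tendsto_rpow_atTop (sub_pos.2 hp)).eventually_ge_atTop ((C + 1) / c)
  obtain ⟨R, hR⟩ := eventually_atTop.1 hev
  refine ⟨|C + 1| * |R|, fun N hN => ?_⟩
  rcases le_total R N with h | h
  · have h1 := (div_le_iff₀ hc).1 (hR N h)
    have h2 : c * N ^ p = N ^ (p - 1) * c * N := by rw [← rpow_sub_one_mul hp hN]; ring
    nlinarith [mul_le_mul_of_nonneg_right h1 hN, abs_nonneg (C + 1), abs_nonneg R,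
      mul_nonneg (abs_nonneg (C + 1)) (abs_nonneg R)]
  · have h1 : (C + 1) * N ≤ |C + 1| * |R| :=
      mul_le_mul (le_abs_self _) (h.trans (le_abs_self _)) hN (abs_nonneg _)
    have : 0 ≤ c * N ^ p := by positivity
    linarith

end FracObstacle

end
noncomputable section

namespace FracObstacle

open Filter Topology

/-! ### An abstract variational inequality -/

/-- A convex class of functions on which the renormalised `p`-energy with respect to `μ` is
controlled by the `L^p(ν)` distance, and which is complete for that distance. -/
structure EnergyClass {X : Type*} [MeasurableSpace X] (p : ℝ) (μ ν : Measure X)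
    (𝒰 : Set (X → ℝ)) : Prop where
  le : ν ≤ μ
  convex : ∀ a ∈ 𝒰, ∀ b ∈ 𝒰, ∀ t : ℝ, 0 ≤ t → t ≤ 1 → (fun x => a x + t * (b x - a x)) ∈ 𝒰
  aestronglyMeasurable : ∀ a ∈ 𝒰, AEStronglyMeasurable a μ
  memLp : ∀ a ∈ 𝒰, MemLp a (ENNReal.ofReal p) ν
  integrable_rpow : ∀ a ∈ 𝒰, ∀ b ∈ 𝒰, Integrable (fun x => |b x - a x| ^ p) μ
  integral_rpow_le : ∃ C, ∀ a ∈ 𝒰, ∀ b ∈ 𝒰,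
    ∫ x, |b x - a x| ^ p ∂μ ≤ C * ∫ x, |b x - a x| ^ p ∂ν
  integrable_dual : ∀ a ∈ 𝒰, ∀ b ∈ 𝒰, Integrable (fun x => |a x| ^ (p - 1) * |b x - a x|) μ
  integral_dual_le : ∀ a ∈ 𝒰, ∃ C, ∀ b ∈ 𝒰,
    ∫ x, |a x| ^ (p - 1) * |b x - a x| ∂μ ≤ C * (∫ x, |b x - a x| ^ p ∂ν) ^ (1 / p)
  complete : ∀ f : ℕ → X → ℝ, (∀ n, f n ∈ 𝒰) →
    (∀ N n m, N ≤ n → N ≤ m → eLpNorm (f n - f m) (ENNReal.ofReal p) ν < 2⁻¹ ^ N) →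
    ∃ a ∈ 𝒰, Tendsto (fun n => eLpNorm (f n - a) (ENNReal.ofReal p) ν) atTop (𝓝 0)

namespace EnergyClass

variable {X : Type*} [MeasurableSpace X] {p : ℝ} {μ ν : Measure X} {𝒰 : Set (X → ℝ)}

/-- The `p`-energy of `b` relative to that of `a`. -/
def relEnergy (p : ℝ) (μ : Measure X) (a b : X → ℝ) : ℝ := ∫ x, (|b x| ^ p - |a x| ^ p) ∂μ

/-- Neither energy need be finite on its own; only the difference is dominated by integrable terms.
-/
theorem integrable_sub_rpow (H : EnergyClass p μ ν 𝒰) (hp : 1 < p) {a b : X → ℝ} (ha : a ∈ 𝒰)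
    (hb : b ∈ 𝒰) : Integrable (fun x => |b x| ^ p - |a x| ^ p) μ := by
  have hm := (H.aestronglyMeasurable a ha).aemeasurable
  have hm' := (H.aestronglyMeasurable b hb).aemeasurable
  refine (((H.integrable_dual a ha b hb).add (H.integrable_rpow a ha b hb)).const_mul
    (p * 2 ^ (p - 1))).mono' (by fun_prop) (ae_of_all _ fun x => ?_)
  have := abs_abs_rpow_sub_le' hp (a x) (b x - a x)
  rwa [add_sub_cancel] at this

theorem abs_relEnergy_le (H : EnergyClass p μ ν 𝒰) (hp : 1 < p) {a b : X → ℝ} (ha : a ∈ 𝒰)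
    (hb : b ∈ 𝒰) : |relEnergy p μ a b| ≤ p * 2 ^ (p - 1) *
      (∫ x, |a x| ^ (p - 1) * |b x - a x| ∂μ + ∫ x, |b x - a x| ^ p ∂μ) := by
  have h1 := H.integrable_dual a ha b hb
  have h2 := H.integrable_rpow a ha b hb
  rw [← integral_add h1 h2, ← integral_const_mul]
  refine (abs_integral_le_integral_abs).trans (integral_mono (H.integrable_sub_rpow hp ha hb).abs
    ((h1.add h2).const_mul _) fun x => ?_)
  have := abs_abs_rpow_sub_le' hp (a x) (b x - a x)
  rwa [add_sub_cancel] at this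

/-- Cocycle rule: changing the reference function shifts the energy by a constant, so minimality
does not depend on the reference. -/
theorem relEnergy_sub (H : EnergyClass p μ ν 𝒰) (hp : 1 < p) {a b c : X → ℝ} (ha : a ∈ 𝒰)
    (hb : b ∈ 𝒰) (hc : c ∈ 𝒰) : relEnergy p μ a c - relEnergy p μ a b = relEnergy p μ b c := by
  unfold relEnergy
  rw [← integral_sub (H.integrable_sub_rpow hp ha hc) (H.integrable_sub_rpow hp ha hb)]
  congr 1; ext x; ring

theorem integrable_rpow_right (H : EnergyClass p μ ν 𝒰) {a b : X → ℝ} (ha : a ∈ 𝒰)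
    (hb : b ∈ 𝒰) : Integrable (fun x => |b x - a x| ^ p) ν :=
  (H.integrable_rpow a ha b hb).mono_measure H.le

theorem integrable_rpow_self (H : EnergyClass p μ ν 𝒰) (hp : 1 < p) {a : X → ℝ} (ha : a ∈ 𝒰) :
    Integrable (fun x => |a x| ^ p) ν := by
  have := (H.memLp a ha).integrable_norm_rpow (by simp; linarith) ENNReal.ofReal_ne_top
  rwa [ENNReal.toReal_ofReal (by linarith)] at this

/-- Coercivity: after integrating `rpow_coercive`, the negative term is at most linear in the L^p(ν)
distance N, while the positive one is of order N^p with p > 1. -/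
theorem exists_relEnergy_ge (H : EnergyClass p μ ν 𝒰) (hp : 1 < p) {a : X → ℝ} (ha : a ∈ 𝒰) :
    ∃ M, ∀ b ∈ 𝒰, (∫ x, |b x - a x| ^ p ∂ν) ^ (1 / p) - M ≤ relEnergy p μ a b := by
  obtain ⟨C, hC⟩ := H.integral_dual_le a ha
  obtain ⟨M, hM⟩ := exists_rpow_sub_linear_ge hp (c := 2⁻¹ ^ p) (by positivity) ((p + 2) * C)
  refine ⟨M, fun b hb => ?_⟩
  have h1 := H.integrable_dual a ha b hb
  have h2 := H.integrable_rpow a ha b hb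
  set N := (∫ x, |b x - a x| ^ p ∂ν) ^ (1 / p) with hN
  have hNp : N ^ p = ∫ x, |b x - a x| ^ p ∂ν := by
    rw [hN, ← Real.rpow_mul (integral_nonneg fun x => by positivity),
      one_div_mul_cancel (by linarith), Real.rpow_one]
  have hle : ∫ x, |b x - a x| ^ p ∂ν ≤ ∫ x, |b x - a x| ^ p ∂μ :=
    integral_mono_measure H.le (ae_of_all _ fun x => by positivity) h2
  have hlow : 2⁻¹ ^ p * ∫ x, |b x - a x| ^ p ∂μ - (p + 2) * ∫ x, |a x| ^ (p - 1) * |b x - a x| ∂μ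
      ≤ relEnergy p μ a b := by
    rw [← integral_const_mul, ← integral_const_mul,
      ← integral_sub (h2.const_mul _) (h1.const_mul _)]
    refine integral_mono ((h2.const_mul _).sub (h1.const_mul _)) (H.integrable_sub_rpow hp ha hb)
      fun x => ?_
    have := rpow_coercive hp (a x) (b x - a x)
    rwa [add_sub_cancel] at this
  have h3 := hM N (Real.rpow_nonneg (integral_nonneg fun x => by positivity) _)
  have h4 : 2⁻¹ ^ p * N ^ p ≤ 2⁻¹ ^ p * ∫ x, |b x - a x| ^ p ∂μ := by
    rw [hNp]; gcongr
  have h5 : (p + 2) * ∫ x, |a x| ^ (p - 1) * |b x - a x| ∂μ ≤ (p + 2) * (C * N) :=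
    mul_le_mul_of_nonneg_left (hC b hb) (by linarith)
  linarith

theorem midpoint_mem (H : EnergyClass p μ ν 𝒰) {a b : X → ℝ} (ha : a ∈ 𝒰)
    (hb : b ∈ 𝒰) : (fun x => (a x + b x) / 2) ∈ 𝒰 := by
  have := H.convex a ha b hb (1 / 2) (by norm_num) (by norm_num)
  convert this using 2
  ring

/-- The defect is an exact combination of three relative energy densities; being nonnegative, its
integral only drops from μ to ν. -/
theorem integral_midDefect_le (H : EnergyClass p μ ν 𝒰) (hp : 1 < p) {a b c : X → ℝ} (ha : a ∈ 𝒰)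
    (hb : b ∈ 𝒰) (hc : c ∈ 𝒰) :
    Integrable (fun x => midDefect p (b x) (c x)) ν ∧
    ∫ x, midDefect p (b x) (c x) ∂ν ≤ (relEnergy p μ a b + relEnergy p μ a c) / 2 -
      relEnergy p μ a (fun x => (b x + c x) / 2) := by
  have h1 := H.integrable_sub_rpow hp ha hb
  have h2 := H.integrable_sub_rpow hp ha hc
  have h3 := H.integrable_sub_rpow hp ha (H.midpoint_mem hb hc)
  have heq : (fun x => midDefect p (b x) (c x)) = fun x =>
      ((|b x| ^ p - |a x| ^ p) + (|c x| ^ p - |a x| ^ p)) / 2 -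
        (|(b x + c x) / 2| ^ p - |a x| ^ p) := by
    ext x; unfold midDefect; ring
  have hi : Integrable (fun x => midDefect p (b x) (c x)) μ := by
    rw [heq]; exact ((h1.add h2).div_const 2).sub h3
  refine ⟨hi.mono_measure H.le, (integral_mono_measure H.le
    (ae_of_all _ fun x => midDefect_nonneg hp _ _) hi).trans_eq ?_⟩
  rw [heq]
  unfold relEnergy
  have h12 : Integrable (fun x => (|b x| ^ p - |a x| ^ p + (|c x| ^ p - |a x| ^ p)) / 2) μ :=
    (h1.add h2).div_const 2
  rw [integral_sub h12 h3, integral_div, integral_add h1 h2]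

/-- Almost minimisers are close together: their midpoint competes too, so the integrated defect is
at most δ, while coercivity bounds their L^p(ν) norms. -/
theorem exists_dist_le_of_relEnergy_le (H : EnergyClass p μ ν 𝒰) (hp : 1 < p) {a : X → ℝ}
    (ha : a ∈ 𝒰) {I : ℝ} (hI : ∀ b ∈ 𝒰, I ≤ relEnergy p μ a b) {η : ℝ} (hη : 0 < η) :
    ∃ δ > 0, ∀ b ∈ 𝒰, ∀ c ∈ 𝒰, relEnergy p μ a b ≤ I + δ → relEnergy p μ a c ≤ I + δ →
      ∫ x, |b x - c x| ^ p ∂ν ≤ η := by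
  have hp0 : 0 < p := by linarith
  obtain ⟨M, hM⟩ := H.exists_relEnergy_ge hp ha
  have hia := H.integrable_rpow_self hp ha
  set R := 2 ^ p * (|I + 1 + M| ^ p + ∫ x, |a x| ^ p ∂ν) with hR
  have hR0 : 0 ≤ R := mul_nonneg (by positivity)
    (add_nonneg (by positivity) (integral_nonneg fun x => by positivity))
  have hbd : ∀ b ∈ 𝒰, relEnergy p μ a b ≤ I + 1 → ∫ x, |b x| ^ p ∂ν ≤ R := by
    intro b hb hE
    have h1 := H.integrable_rpow_right ha hb
    have h2 : (∫ x, |b x - a x| ^ p ∂ν) ^ (1 / p) ≤ |I + 1 + M| :=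
      le_trans (by linarith [hM b hb]) (le_abs_self _)
    have h3 : ∫ x, |b x - a x| ^ p ∂ν ≤ |I + 1 + M| ^ p := by
      have := Real.rpow_le_rpow (Real.rpow_nonneg (integral_nonneg fun x => by positivity) _)
        h2 hp0.le
      rwa [← Real.rpow_mul (integral_nonneg fun x => by positivity),
        one_div_mul_cancel hp0.ne', Real.rpow_one] at this
    calc ∫ x, |b x| ^ p ∂ν ≤ ∫ x, 2 ^ p * (|b x - a x| ^ p + |a x| ^ p) ∂ν := by
          refine integral_mono (H.integrable_rpow_self hp hb) ((h1.add hia).const_mul _)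
            fun x => ?_
          have := abs_sub_rpow_le hp0.le (b x - a x) (-a x)
          simpa using this
      _ = 2 ^ p * (∫ x, |b x - a x| ^ p ∂ν + ∫ x, |a x| ^ p ∂ν) := by
          rw [integral_const_mul, integral_add h1 hia]
      _ ≤ R := by rw [hR]; gcongr
  -- With both p-th powers bounded by R, this ε makes the error part at most η/2. The choice of δ
  -- below makes the defect part at most η/2, and δ ≤ 1 puts both functions under the bound R.
  have hε : 0 < η / (4 * (R + 1)) := by positivity
  obtain ⟨C, hC0, hC⟩ := abs_sub_rpow_le_midDefect hp hε
  refine ⟨min 1 (η / (2 * (C + 1))), by positivity, fun b hb c hc hEb hEc => ?_⟩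
  have hδ1 := min_le_left 1 (η / (2 * (C + 1)))
  have hδ2 := min_le_right 1 (η / (2 * (C + 1)))
  set δ := min 1 (η / (2 * (C + 1)))
  obtain ⟨hdi, hd⟩ := H.integral_midDefect_le hp ha hb hc
  have hmid := hI _ (H.midpoint_mem hb hc)
  have hd' : ∫ x, midDefect p (b x) (c x) ∂ν ≤ η / (2 * (C + 1)) := by linarith
  have hib := H.integrable_rpow_self hp hb
  have hic := H.integrable_rpow_self hp hc
  have hbc : Integrable (fun x => η / (4 * (R + 1)) * (|b x| ^ p + |c x| ^ p)) ν :=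
    (hib.add hic).const_mul _
  have hb' := hbd b hb (by linarith)
  have hc' := hbd c hc (by linarith)
  calc ∫ x, |b x - c x| ^ p ∂ν
      ≤ ∫ x, (C * midDefect p (b x) (c x) + η / (4 * (R + 1)) * (|b x| ^ p + |c x| ^ p)) ∂ν :=
        integral_mono (H.integrable_rpow_right hc hb)
          ((hdi.const_mul _).add ((hib.add hic).const_mul _)) fun x => hC _ _
    _ = C * ∫ x, midDefect p (b x) (c x) ∂ν
        + η / (4 * (R + 1)) * (∫ x, |b x| ^ p ∂ν + ∫ x, |c x| ^ p ∂ν) := by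
        rw [integral_add (hdi.const_mul _) hbc, integral_const_mul,
          integral_const_mul, integral_add hib hic]
    _ ≤ (C + 1) * (η / (2 * (C + 1))) + η / (4 * (R + 1)) * (2 * (R + 1)) := by
        have : 0 ≤ ∫ x, midDefect p (b x) (c x) ∂ν :=
          integral_nonneg fun x => midDefect_nonneg hp _ _
        gcongr <;> linarith
    _ = η := by field_simp; norm_num

theorem exists_isMin (H : EnergyClass p μ ν 𝒰) (hp : 1 < p) (hne : 𝒰.Nonempty) :
    ∃ a ∈ 𝒰, ∀ b ∈ 𝒰, 0 ≤ relEnergy p μ a b := by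
  have hp0 : 0 < p := by linarith
  obtain ⟨e, he⟩ := hne
  obtain ⟨M, hM⟩ := H.exists_relEnergy_ge hp he
  set S := relEnergy p μ e '' 𝒰
  have hSb : BddBelow S := by
    refine ⟨-M, ?_⟩
    rintro _ ⟨b, hb, rfl⟩
    have : 0 ≤ (∫ x, |b x - e x| ^ p ∂ν) ^ (1 / p) :=
      Real.rpow_nonneg (integral_nonneg fun x => by positivity) _
    linarith [hM b hb]
  have hSn : S.Nonempty := ⟨_, e, he, rfl⟩
  set I := sInf S
  have hI : ∀ b ∈ 𝒰, I ≤ relEnergy p μ e b := fun b hb => csInf_le hSb ⟨b, hb, rfl⟩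
  -- Half of 2⁻ⁿ, because the completeness hypothesis asks for a strict inequality between norms.
  have hη : ∀ n : ℕ, (0 : ℝ) < ((2⁻¹ : ℝ) ^ n / 2) ^ p := fun n => by positivity
  choose δ hδ0 hδ using fun n => H.exists_dist_le_of_relEnergy_le hp he hI (hη n)
  -- Minimum over all indices up to n, so that every term from N onwards meets the tolerance `δ N`;
  -- the factor 2⁻ⁿ makes the energies tend to the infimum.
  set δ' : ℕ → ℝ := fun n =>
    min ((2⁻¹ : ℝ) ^ n) ((Finset.range (n + 1)).inf' ⟨0, by simp⟩ δ)
  have hδ'0 : ∀ n, 0 < δ' n := fun n =>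
    lt_min (by positivity) ((Finset.lt_inf'_iff _).2 fun i _ => hδ0 i)
  have hδ'le : ∀ N n, N ≤ n → δ' n ≤ δ N := fun N n h =>
    (min_le_right _ _).trans (Finset.inf'_le _ (by simp; omega))
  have hex : ∀ n, ∃ b ∈ 𝒰, relEnergy p μ e b ≤ I + δ' n := fun n => by
    obtain ⟨_, ⟨b, hb, rfl⟩, h⟩ := exists_lt_of_csInf_lt hSn
      (show sInf S < I + δ' n by linarith [hδ'0 n])
    exact ⟨b, hb, h.le⟩
  choose f hf hfE using hex
  have hnorm : ∀ b ∈ 𝒰, ∀ c ∈ 𝒰, eLpNorm (b - c) (ENNReal.ofReal p) ν =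
      ENNReal.ofReal ((∫ x, |b x - c x| ^ p ∂ν) ^ (1 / p)) := by
    intro b hb c hc
    rw [((H.memLp b hb).sub (H.memLp c hc)).eLpNorm_eq_integral_rpow_norm (by simpa using hp0)
      ENNReal.ofReal_ne_top, ENNReal.toReal_ofReal hp0.le, one_div]
    rfl
  obtain ⟨a, ha, hlim⟩ := H.complete f hf (by
    intro N n m hn hm
    have h1 := hδ N (f n) (hf n) (f m) (hf m)
      ((hfE n).trans (by linarith [hδ'le N n hn])) ((hfE m).trans (by linarith [hδ'le N m hm]))
    rw [hnorm _ (hf n) _ (hf m)]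
    have h2 := Real.rpow_le_rpow (integral_nonneg fun x => by positivity) h1
      (by positivity : 0 ≤ 1 / p)
    rw [← Real.rpow_mul (by positivity), mul_one_div_cancel hp0.ne', Real.rpow_one] at h2
    refine (ENNReal.ofReal_lt_ofReal_iff (by positivity)).2
      (h2.trans_lt (half_lt_self (by positivity : (0 : ℝ) < 2⁻¹ ^ N))) |>.trans_eq ?_
    rw [ENNReal.ofReal_pow (by norm_num), ENNReal.ofReal_inv_of_pos (by norm_num)]
    simp)
  set N : ℕ → ℝ := fun n => (∫ x, |f n x - a x| ^ p ∂ν) ^ (1 / p)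
  have hN0 : ∀ n, 0 ≤ N n := fun n => Real.rpow_nonneg (integral_nonneg fun x => by positivity) _
  have hNlim : Tendsto N atTop (𝓝 0) := by
    have h1 := (ENNReal.tendsto_toReal ENNReal.zero_ne_top).comp hlim
    refine h1.congr fun n => ?_
    simp only [Function.comp, hnorm _ (hf n) _ ha]
    exact ENNReal.toReal_ofReal (hN0 n)
  have hNp : ∀ n, ∫ x, |f n x - a x| ^ p ∂ν = N n ^ p := fun n => by
    rw [← Real.rpow_mul (integral_nonneg fun x => by positivity),
      one_div_mul_cancel hp0.ne', Real.rpow_one]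
  obtain ⟨C₁, hC₁⟩ := H.integral_dual_le a ha
  obtain ⟨C₂, hC₂⟩ := H.integral_rpow_le
  -- The relative energy from `a` to `f n` is controlled by N n, so the energy of the limit is at
  -- most the limit of the energies.
  have hup : ∀ n, relEnergy p μ e a ≤ I + 2⁻¹ ^ n +
      p * 2 ^ (p - 1) * (C₁ * N n + C₂ * N n ^ p) := by
    intro n
    have h1 := H.abs_relEnergy_le hp ha (hf n)
    have h2 := H.relEnergy_sub hp he ha (hf n)
    have h3 := hC₁ (f n) (hf n)
    have h4 := hC₂ a ha (f n) (hf n)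
    rw [hNp] at h4
    have h5 : p * 2 ^ (p - 1) * (∫ x, |a x| ^ (p - 1) * |f n x - a x| ∂μ
        + ∫ x, |f n x - a x| ^ p ∂μ) ≤ p * 2 ^ (p - 1) * (C₁ * N n + C₂ * N n ^ p) := by
      gcongr
    have h6 := neg_abs_le (relEnergy p μ a (f n))
    have h7 := hfE n
    have h8 : δ' n ≤ 2⁻¹ ^ n := min_le_left _ _
    linarith
  have hNplim : Tendsto (fun n => N n ^ p) atTop (𝓝 0) := by
    have := hNlim.rpow_const (p := p) (Or.inr hp0.le)
    rwa [Real.zero_rpow hp0.ne'] at this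
  have hlim2 : Tendsto (fun n => I + 2⁻¹ ^ n + p * 2 ^ (p - 1) * (C₁ * N n + C₂ * N n ^ p))
      atTop (𝓝 I) := by
    have h := ((tendsto_const_nhds (x := I)).add (tendsto_pow_atTop_nhds_zero_of_lt_one
      (by norm_num : (0 : ℝ) ≤ 2⁻¹) (by norm_num))).add
      (((hNlim.const_mul C₁).add (hNplim.const_mul C₂)).const_mul (p * 2 ^ (p - 1)))
    simpa using h
  have hfin : relEnergy p μ e a ≤ I := ge_of_tendsto' hlim2 hup
  refine ⟨a, ha, fun b hb => ?_⟩
  rw [← H.relEnergy_sub hp he ha hb]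
  linarith [hI b hb]

/-! ### First variation and uniqueness in the abstract class. -/

theorem integrable_oddPow_mul (H : EnergyClass p μ ν 𝒰) (hp : 1 < p) {a b : X → ℝ} (ha : a ∈ 𝒰)
    (hb : b ∈ 𝒰) : Integrable (fun x => oddPow p (a x) * (b x - a x)) μ := by
  have hm := (H.aestronglyMeasurable a ha).aemeasurable
  have hm' := (H.aestronglyMeasurable b hb).aemeasurable
  refine (H.integrable_dual a ha b hb).mono' ?_ (ae_of_all _ fun x => ?_)
  · exact (((measurable_oddPow p).comp_aemeasurable hm).mul (hm'.sub hm)).aestronglyMeasurable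
  · rw [Real.norm_eq_abs, abs_mul, abs_oddPow hp]

theorem integral_oddPow_mul_nonneg (H : EnergyClass p μ ν 𝒰) (hp : 1 < p) {a b : X → ℝ}
    (ha : a ∈ 𝒰) (hmin : ∀ b ∈ 𝒰, 0 ≤ relEnergy p μ a b) (hb : b ∈ 𝒰) :
    0 ≤ ∫ x, oddPow p (a x) * (b x - a x) ∂μ := by
  have hp0 : 0 < p := by linarith
  set t : ℕ → ℝ := fun k => 1 / ((k : ℝ) + 1)
  have ht0 : ∀ k, 0 < t k := fun k => by positivity
  have ht1 : ∀ k, t k ≤ 1 := fun k => by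
    rw [div_le_one (by positivity)]; linarith [(Nat.cast_nonneg k : (0 : ℝ) ≤ k)]
  have htl : Tendsto t atTop (𝓝 0) := tendsto_one_div_add_atTop_nhds_zero_nat
  have hmem := fun k => H.convex a ha b hb (t k) (ht0 k).le (ht1 k)
  set F : ℕ → X → ℝ := fun k x => (t k)⁻¹ * (|a x + t k * (b x - a x)| ^ p - |a x| ^ p)
  have hF : Tendsto (fun k => ∫ x, F k x ∂μ) atTop
      (𝓝 (∫ x, p * oddPow p (a x) * (b x - a x) ∂μ)) := by
    refine tendsto_integral_of_dominated_convergence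
      (fun x => p * 2 ^ (p - 1) * (|a x| ^ (p - 1) * |b x - a x| + |b x - a x| ^ p)) ?_ ?_ ?_ ?_
    · exact fun k => ((H.integrable_sub_rpow hp ha (hmem k)).const_mul _).aestronglyMeasurable
    · exact ((H.integrable_dual a ha b hb).add (H.integrable_rpow a ha b hb)).const_mul _
    · refine fun k => ae_of_all _ fun x => ?_
      have h1 := abs_abs_rpow_sub_le' hp (a x) (t k * (b x - a x))
      rw [Real.norm_eq_abs, abs_mul, abs_inv, abs_of_pos (ht0 k), inv_mul_le_iff₀ (ht0 k)]
      refine h1.trans ?_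
      rw [abs_mul, abs_of_pos (ht0 k), Real.mul_rpow (ht0 k).le (abs_nonneg _)]
      -- This is what makes the majorant of the difference quotients independent of k.
      have h2 : t k ^ p ≤ t k := by
        simpa using Real.rpow_le_rpow_of_exponent_ge (ht0 k) (ht1 k) hp.le
      calc p * 2 ^ (p - 1) * (|a x| ^ (p - 1) * (t k * |b x - a x|) + t k ^ p * |b x - a x| ^ p)
          ≤ p * 2 ^ (p - 1) * (|a x| ^ (p - 1) * (t k * |b x - a x|) + t k * |b x - a x| ^ p) := by
            gcongr
        _ = _ := by ring
    · refine ae_of_all _ fun x => ?_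
      have hd : HasDerivAt (fun τ : ℝ => |a x + τ * (b x - a x)| ^ p)
          (p * oddPow p (a x) * (b x - a x)) 0 := by
        have h1 : HasDerivAt (fun τ : ℝ => a x + τ * (b x - a x)) (b x - a x) 0 := by
          simpa using ((hasDerivAt_id (0 : ℝ)).mul_const (b x - a x)).const_add (a x)
        have h2 : HasDerivAt (fun y : ℝ => |y| ^ p) (p * oddPow p (a x))
            (a x + 0 * (b x - a x)) := by
          simpa using hasDerivAt_abs_rpow_oddPow hp (a x)
        exact h2.comp 0 h1
      have h3 := hd.tendsto_slope_zero.comp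
        (tendsto_nhdsWithin_iff.2 ⟨htl, Eventually.of_forall fun k => (ht0 k).ne'⟩)
      simpa [F, Function.comp_def] using h3
  have hnn : ∀ k, 0 ≤ ∫ x, F k x ∂μ := fun k => by
    rw [integral_const_mul]
    exact mul_nonneg (inv_nonneg.2 (ht0 k).le) (hmin _ (hmem k))
  have := ge_of_tendsto' hF hnn
  simp only [mul_assoc] at this
  rw [integral_const_mul] at this
  exact nonneg_of_mul_nonneg_right this hp0

theorem exists_variational (H : EnergyClass p μ ν 𝒰) (hp : 1 < p) (hne : 𝒰.Nonempty) :
    ∃ a ∈ 𝒰, ∀ b ∈ 𝒰, 0 ≤ ∫ x, oddPow p (a x) * (b x - a x) ∂μ := by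
  obtain ⟨a, ha, hmin⟩ := H.exists_isMin hp hne
  exact ⟨a, ha, fun b hb => H.integral_oddPow_mul_nonneg hp ha hmin hb⟩

theorem ae_eq_of_variational (H : EnergyClass p μ ν 𝒰) (hp : 1 < p) {a b : X → ℝ} (ha : a ∈ 𝒰)
    (hb : b ∈ 𝒰) (h₁ : 0 ≤ ∫ x, oddPow p (a x) * (b x - a x) ∂μ)
    (h₂ : 0 ≤ ∫ x, oddPow p (b x) * (a x - b x) ∂μ) : a =ᵐ[μ] b := by
  have hi := H.integrable_oddPow_mul hp ha hb
  have hi' := H.integrable_oddPow_mul hp hb ha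
  have heq : (fun x => (oddPow p (a x) - oddPow p (b x)) * (a x - b x)) = fun x =>
      -(oddPow p (a x) * (b x - a x) + oddPow p (b x) * (a x - b x)) := by ext x; ring
  have hint : Integrable (fun x => (oddPow p (a x) - oddPow p (b x)) * (a x - b x)) μ := by
    rw [heq]; exact (hi.add hi').neg
  -- The two variational inequalities add up to a nonpositive integral of a nonnegative integrand.
  have hz : ∫ x, (oddPow p (a x) - oddPow p (b x)) * (a x - b x) ∂μ = 0 := by
    refine le_antisymm ?_ (integral_nonneg fun x => oddPow_monotone_mul hp _ _)
    rw [heq, integral_neg, integral_add hi hi']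
    linarith
  have := (integral_eq_zero_iff_of_nonneg (fun x => oddPow_monotone_mul hp _ _) hint).1 hz
  filter_upwards [this] with x hx
  exact eq_of_oddPow_mul_eq_zero hp hx

end EnergyClass

end FracObstacle

end
noncomputable section

namespace FracObstacle

open Filter Topology

/-! ### The kernel measure and the basic estimates -/

/-- The standing assumptions on the parameters, the kernel and the two domains. -/
structure Setting {n : ℕ} (s p Λ : ℝ) (K : E n → E n → ℝ) (Ω Ω' : Set (E n)) : Prop where
  dim_pos : 1 ≤ n
  s_pos : 0 < s
  s_lt_one : s < 1
  one_lt_p : 1 < p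
  one_le_Λ : 1 ≤ Λ
  kernel : IsKernel s p Λ K
  isOpen : IsOpen Ω
  isOpen' : IsOpen Ω'
  isBounded' : Bornology.IsBounded Ω'
  contained : CompactlyContained Ω Ω'

/-- The difference `u(x) - u(y)` as a function on pairs. -/
def pairDiff {n : ℕ} (u : E n → ℝ) (z : E n × E n) : ℝ := u z.1 - u z.2

/-- The measure `K(x, y) dx dy`. -/
def kernelMeasure {n : ℕ} (K : E n → E n → ℝ) : Measure (E n × E n) :=
  volume.withDensity fun z => ENNReal.ofReal (K z.1 z.2)

theorem ofReal_abs_rpow {q : ℝ} (hq : 0 ≤ q) (x : ℝ) :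
    ENNReal.ofReal (|x| ^ q) = ‖x‖ₑ ^ q := by
  rw [Real.enorm_eq_ofReal_abs, ENNReal.ofReal_rpow_of_nonneg (abs_nonneg x) hq]

theorem enorm_sub_rpow_le {q : ℝ} (hq : 0 ≤ q) (a b : ℝ) :
    ‖a - b‖ₑ ^ q ≤ ENNReal.ofReal (2 ^ q) * (‖a‖ₑ ^ q + ‖b‖ₑ ^ q) := by
  rw [← ofReal_abs_rpow hq, ← ofReal_abs_rpow hq, ← ofReal_abs_rpow hq,
    ← ENNReal.ofReal_add (by positivity) (by positivity), ← ENNReal.ofReal_mul (by positivity)]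
  exact ENNReal.ofReal_le_ofReal (abs_sub_rpow_le hq a b)

theorem lintegral_enorm_rpow_lt_top_of_memLp {X : Type*} [MeasurableSpace X] {μ : Measure X}
    {p : ℝ} (hp : 0 < p) {f : X → ℝ} (hf : MemLp f (ENNReal.ofReal p) μ) :
    ∫⁻ x, ‖f x‖ₑ ^ p ∂μ < ⊤ := by
  have := lintegral_rpow_enorm_lt_top_of_eLpNorm_lt_top (by simpa using hp)
    ENNReal.ofReal_ne_top hf.2
  rwa [ENNReal.toReal_ofReal hp.le] at this

theorem memLp_iff_lintegral_enorm_rpow_lt_top {X : Type*} [MeasurableSpace X] {μ : Measure X}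
    {p : ℝ} (hp : 0 < p) {f : X → ℝ} (hf : AEStronglyMeasurable f μ) :
    MemLp f (ENNReal.ofReal p) μ ↔ ∫⁻ x, ‖f x‖ₑ ^ p ∂μ < ⊤ := by
  refine ⟨lintegral_enorm_rpow_lt_top_of_memLp hp, fun h => ⟨hf, ?_⟩⟩
  rw [eLpNorm_lt_top_iff_lintegral_rpow_enorm_lt_top (by simpa using hp) ENNReal.ofReal_ne_top,
    ENNReal.toReal_ofReal hp.le]
  exact h

/-- Hölder with exponents p' and p, using (p - 1) p' = p. -/
theorem lintegral_rpow_mul_le {X : Type*} [MeasurableSpace X] (μ : Measure X) {p : ℝ} (hp : 1 < p)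
    {f h : X → ℝ≥0∞} (hf : AEMeasurable f μ) (hh : AEMeasurable h μ) :
    ∫⁻ x, f x ^ (p - 1) * h x ∂μ ≤
      (∫⁻ x, f x ^ p ∂μ) ^ (1 / p.conjExponent) * (∫⁻ x, h x ^ p ∂μ) ^ (1 / p) := by
  have hc := (Real.HolderConjugate.conjExponent hp).symm
  have := ENNReal.lintegral_mul_le_Lp_mul_Lq μ hc (hf.pow_const (p - 1)) hh
  have he : (p - 1) * p.conjExponent = p := by
    rw [Real.conjExponent, mul_div_cancel₀]
    linarith
  simpa only [Pi.mul_apply, ← ENNReal.rpow_mul, he] using this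

section

variable {n : ℕ} {s p Λ : ℝ} {K : E n → E n → ℝ} {Ω Ω' : Set (E n)}

theorem kernelMeasure_absolutelyContinuous : kernelMeasure K ≪ volume :=
  withDensity_absolutelyContinuous _ _

theorem pairDiff_aestronglyMeasurable {u : E n → ℝ} (hu : AEStronglyMeasurable u volume) :
    AEStronglyMeasurable (pairDiff u) (volume : Measure (E n × E n)) :=
  hu.comp_fst.sub hu.comp_snd

theorem enorm_pairDiff_aemeasurable {u : E n → ℝ} (hu : AEStronglyMeasurable u volume) (q : ℝ) :
    AEMeasurable (fun z => ‖pairDiff u z‖ₑ ^ q) (volume : Measure (E n × E n)) :=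
  (pairDiff_aestronglyMeasurable hu).enorm.pow_const q

theorem ae_fst_and_snd {P : E n → Prop} (h : ∀ᵐ x, P x) :
    ∀ᵐ z : E n × E n, P z.1 ∧ P z.2 := by
  have h1 : ∀ᵐ z ∂((volume : Measure (E n)).prod (volume : Measure (E n))), P z.1 :=
    Measure.quasiMeasurePreserving_fst.ae h
  have h2 : ∀ᵐ z ∂((volume : Measure (E n)).prod (volume : Measure (E n))), P z.2 :=
    Measure.quasiMeasurePreserving_snd.ae h
  exact h1.and h2

theorem setLIntegral_kernelMeasure (hK : IsKernel s p Λ K) {S : Set (E n × E n)}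
    (hS : MeasurableSet S) {f : E n × E n → ℝ≥0∞} (hf : AEMeasurable f volume) :
    ∫⁻ z in S, f z ∂(kernelMeasure K) = ∫⁻ z in S, ENNReal.ofReal (K z.1 z.2) * f z := by
  rw [kernelMeasure, restrict_withDensity hS,
    lintegral_withDensity_eq_lintegral_mul₀ hK.aemeasurable.ennreal_ofReal.restrict hf.restrict]
  rfl

theorem setLIntegral_kernelMeasure_swap (hK : IsKernel s p Λ K) {S T : Set (E n)}
    (hS : MeasurableSet S) (hT : MeasurableSet T) {f : E n × E n → ℝ≥0∞}
    (hf : AEMeasurable f volume) (hsymm : ∀ x y, f (x, y) = f (y, x)) :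
    ∫⁻ z in S ×ˢ T, f z ∂(kernelMeasure K) = ∫⁻ z in T ×ˢ S, f z ∂(kernelMeasure K) := by
  rw [setLIntegral_kernelMeasure hK (hS.prod hT) hf, setLIntegral_kernelMeasure hK (hT.prod hS) hf]
  have hmp : MeasurePreserving (Prod.swap : E n × E n → E n × E n) volume volume :=
    Measure.measurePreserving_swap
  have h := hmp.setLIntegral_comp_preimage_emb MeasurableEquiv.prodComm.measurableEmbedding
    (fun z => ENNReal.ofReal (K z.1 z.2) * f z) (S ×ˢ T)
  rw [← h, Set.preimage_swap_prod]
  refine lintegral_congr fun z => ?_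
  rw [Prod.fst_swap, Prod.snd_swap, hK.symm z.2 z.1, show f z.swap = f z from hsymm z.2 z.1]

namespace Setting

theorem exponent_pos (S : Setting s p Λ K Ω Ω') : 0 < (n : ℝ) + s * p := by
  have := S.s_pos
  have := S.one_lt_p
  positivity

theorem subset (S : Setting s p Λ K Ω Ω') : Ω ⊆ Ω' := subset_closure.trans S.contained.2

theorem Λ_pos (S : Setting s p Λ K Ω Ω') : 0 < Λ := one_pos.trans_le S.one_le_Λ

theorem ae_kernel (S : Setting s p Λ K Ω Ω') : ∀ᵐ z : E n × E n,
    0 < ‖z.1 - z.2‖ ∧ 1 / ‖z.1 - z.2‖ ^ ((n : ℝ) + s * p) ≤ Λ * K z.1 z.2 ∧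
      K z.1 z.2 ≤ Λ * (1 / ‖z.1 - z.2‖ ^ ((n : ℝ) + s * p)) := by
  filter_upwards [S.kernel.bounds] with z ⟨h1, h2⟩
  have hΛ := S.Λ_pos
  have hr : 0 < ‖z.1 - z.2‖ := by
    rcases (norm_nonneg (z.1 - z.2)).eq_or_lt with h | h
    -- On the diagonal the power of the distance is 0, which contradicts the positive lower bound;
    -- the diagonal is thus excluded by ellipticity itself.
    · rw [← h, Real.zero_rpow S.exponent_pos.ne', mul_zero] at h1
      exact absurd h1 (not_le.2 (inv_pos.2 hΛ))
    · exact h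
  have hrα : 0 < ‖z.1 - z.2‖ ^ ((n : ℝ) + s * p) := Real.rpow_pos_of_pos hr _
  refine ⟨hr, ?_, ?_⟩
  · rw [div_le_iff₀ hrα, mul_assoc]
    rwa [inv_le_iff_one_le_mul₀' hΛ] at h1
  · rw [mul_one_div, le_div_iff₀ hrα]
    exact h2

theorem gagliardo_integrand_eq (hp : 1 < p) (u : E n → ℝ) (z : E n × E n) :
    ENNReal.ofReal (|u z.1 - u z.2| ^ p / ‖z.1 - z.2‖ ^ ((n : ℝ) + s * p)) =
      ENNReal.ofReal (1 / ‖z.1 - z.2‖ ^ ((n : ℝ) + s * p)) * ‖pairDiff u z‖ₑ ^ p := by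
  rw [← ofReal_abs_rpow (by linarith), ← ENNReal.ofReal_mul (by positivity), pairDiff]
  congr 1; ring

theorem lintegral_rpow_le_gagliardoEnergy (S : Setting s p Λ K Ω Ω') {u : E n → ℝ}
    (hu : AEStronglyMeasurable u volume) {D : Set (E n)} (hD : MeasurableSet D) :
    ∫⁻ z in D ×ˢ D, ‖pairDiff u z‖ₑ ^ p ∂(kernelMeasure K) ≤
      ENNReal.ofReal Λ * gagliardoEnergy s p D u := by
  rw [setLIntegral_kernelMeasure S.kernel (hD.prod hD) (enorm_pairDiff_aemeasurable hu p),
    gagliardoEnergy, ← lintegral_const_mul' _ _ ENNReal.ofReal_ne_top]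
  refine lintegral_mono_ae (ae_restrict_of_ae ?_)
  filter_upwards [S.ae_kernel] with z hz
  rw [gagliardo_integrand_eq S.one_lt_p, ← mul_assoc, ← ENNReal.ofReal_mul S.Λ_pos.le]
  gcongr
  exact hz.2.2

theorem gagliardoEnergy_le_lintegral_rpow (S : Setting s p Λ K Ω Ω') {u : E n → ℝ}
    (hu : AEStronglyMeasurable u volume) {D : Set (E n)} (hD : MeasurableSet D) :
    gagliardoEnergy s p D u ≤
      ENNReal.ofReal Λ * ∫⁻ z in D ×ˢ D, ‖pairDiff u z‖ₑ ^ p ∂(kernelMeasure K) := by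
  rw [setLIntegral_kernelMeasure S.kernel (hD.prod hD) (enorm_pairDiff_aemeasurable hu p),
    gagliardoEnergy, ← lintegral_const_mul' _ _ ENNReal.ofReal_ne_top]
  refine lintegral_mono_ae (ae_restrict_of_ae ?_)
  filter_upwards [S.ae_kernel] with z hz
  rw [gagliardo_integrand_eq S.one_lt_p, ← mul_assoc, ← ENNReal.ofReal_mul S.Λ_pos.le]
  gcongr
  exact hz.2.1

/-- Ellipticity makes the Gagliardo energy on Ω' comparable to the p-th power of the L^p(ν) norm of
the increments. -/
theorem memW_iff (S : Setting s p Λ K Ω Ω') {u : E n → ℝ} (hu : AEStronglyMeasurable u volume) :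
    MemW s p Ω' u ↔ MemLp u (ENNReal.ofReal p) (volume.restrict Ω') ∧
      MemLp (pairDiff u) (ENNReal.ofReal p) ((kernelMeasure K).restrict (Ω' ×ˢ Ω')) := by
  have hp0 : 0 < p := by linarith [S.one_lt_p]
  have hm := S.isOpen'.measurableSet
  rw [MemW, memLp_iff_lintegral_enorm_rpow_lt_top (f := pairDiff u) hp0
    ((pairDiff_aestronglyMeasurable hu).mono_ac kernelMeasure_absolutelyContinuous).restrict]
  refine and_congr_right fun _ => ⟨fun h => ?_, fun h => ?_⟩
  · exact (S.lintegral_rpow_le_gagliardoEnergy hu hm).trans_lt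
      (ENNReal.mul_lt_top ENNReal.ofReal_lt_top h)
  · exact (S.gagliardoEnergy_le_lintegral_rpow hu hm).trans_lt
      (ENNReal.mul_lt_top ENNReal.ofReal_lt_top h)

/-- Otherwise this open set would be empty and Ω' = closure Ω would be clopen, hence empty or the
whole space, against Ω ≠ ∅ or boundedness in dimension n ≥ 1. -/
theorem volume_diff_pos (S : Setting s p Λ K Ω Ω') (hne : Ω.Nonempty) :
    0 < volume (Ω' \ closure Ω) := by
  refine (S.isOpen'.sdiff isClosed_closure).measure_pos _ (Set.nonempty_iff_ne_empty.2 fun h => ?_)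
  have heq : Ω' = closure Ω := (Set.sdiff_eq_empty.1 h).antisymm S.contained.2
  have hcl : IsClopen Ω' := ⟨heq ▸ isClosed_closure, S.isOpen'⟩
  rcases isClopen_iff.1 hcl with h0 | h0
  · exact (hne.mono S.subset).ne_empty h0
  · have : Nonempty (Fin n) := ⟨⟨0, S.dim_pos⟩⟩
    have hb := S.isBounded'
    rw [h0] at hb
    exact NormedSpace.unbounded_univ ℝ (E n) hb

/-- The fractional Poincaré inequality for functions that vanish outside `Ω`. -/
theorem exists_poincare (S : Setting s p Λ K Ω Ω') : ∃ C : ℝ≥0∞, C ≠ ⊤ ∧ ∀ w : E n → ℝ,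
    AEStronglyMeasurable w volume → (∀ᵐ x, x ∉ Ω → w x = 0) →
    ∫⁻ x, ‖w x‖ₑ ^ p ≤
      C * ∫⁻ z in Ω' ×ˢ Ω', ‖pairDiff w z‖ₑ ^ p ∂(kernelMeasure K) := by
  have hp0 : 0 < p := by linarith [S.one_lt_p]
  have hred : ∀ w : E n → ℝ, (∀ᵐ x, x ∉ Ω → w x = 0) →
      ∫⁻ x, ‖w x‖ₑ ^ p = ∫⁻ x in Ω, ‖w x‖ₑ ^ p := by
    intro w hw
    rw [← lintegral_indicator S.isOpen.measurableSet]
    refine lintegral_congr_ae ?_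
    filter_upwards [hw] with x hx
    by_cases h : x ∈ Ω
    · simp [h]
    · simp [h, hx h, hp0]
  rcases Ω.eq_empty_or_nonempty with h0 | hne
  · refine ⟨0, by simp, fun w _ hw => ?_⟩
    rw [hred w hw, h0]; simp
  -- For y in N one has w(y) = 0 almost everywhere, so |w(x)| = |w(x) - w(y)|; averaging over N
  -- costs only the lower bound c of the kernel, as |x - y| ≤ 2R.
  set N := Ω' \ closure Ω
  have hNm : MeasurableSet N := (S.isOpen'.sdiff isClosed_closure).measurableSet
  have hNpos := S.volume_diff_pos hne
  have hNfin : volume N < ⊤ := (S.isBounded'.subset Set.sdiff_subset).measure_lt_top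
  obtain ⟨R, hR0, hR⟩ := S.isBounded'.exists_pos_norm_le
  set c : ℝ := Λ⁻¹ * (1 / (2 * R) ^ ((n : ℝ) + s * p))
  have hc0 : 0 < c := mul_pos (inv_pos.2 S.Λ_pos) (by positivity)
  have hcN : ENNReal.ofReal c * volume N ≠ 0 := by
    refine mul_ne_zero ?_ hNpos.ne'
    simpa using hc0
  have hcN' : ENNReal.ofReal c * volume N ≠ ⊤ :=
    ENNReal.mul_ne_top ENNReal.ofReal_ne_top hNfin.ne
  refine ⟨(ENNReal.ofReal c * volume N)⁻¹, ENNReal.inv_ne_top.2 hcN, fun w hwm hw => ?_⟩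
  rw [hred w hw, ← ENNReal.div_eq_inv_mul, ENNReal.le_div_iff_mul_le (Or.inl hcN) (Or.inl hcN')]
  have hsub : Ω ×ˢ N ⊆ Ω' ×ˢ Ω' := Set.prod_mono S.subset Set.sdiff_subset
  have hvol : (volume : Measure (E n × E n)).restrict (Ω ×ˢ N) =
      (volume.restrict Ω).prod (volume.restrict N) := by
    rw [Measure.prod_restrict]; rfl
  calc (∫⁻ x in Ω, ‖w x‖ₑ ^ p) * (ENNReal.ofReal c * volume N)
      = ∫⁻ z in Ω ×ˢ N, ‖w z.1‖ₑ ^ p * ENNReal.ofReal c := by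
        rw [hvol, lintegral_prod_mul (f := fun x => ‖w x‖ₑ ^ p) (g := fun _ => ENNReal.ofReal c)
          (hwm.restrict.enorm.pow_const p) aemeasurable_const]
        simp
    _ ≤ ∫⁻ z in Ω ×ˢ N, ENNReal.ofReal (K z.1 z.2) * ‖pairDiff w z‖ₑ ^ p := by
        refine lintegral_mono_ae ?_
        filter_upwards [ae_restrict_mem (S.isOpen.measurableSet.prod hNm),
          ae_restrict_of_ae S.ae_kernel, ae_restrict_of_ae (ae_fst_and_snd hw)] with z hz hk hwz
        have hw2 : w z.2 = 0 := hwz.2 fun h => hz.2.2 (subset_closure h)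
        rw [pairDiff, hw2, sub_zero, mul_comm]
        gcongr
        have hd : ‖z.1 - z.2‖ ≤ 2 * R := by
          have h1 := hR _ (S.subset hz.1)
          have h2 := hR _ hz.2.1
          linarith [norm_sub_le z.1 z.2]
        have h3 : 1 / (2 * R) ^ ((n : ℝ) + s * p) ≤ 1 / ‖z.1 - z.2‖ ^ ((n : ℝ) + s * p) :=
          one_div_le_one_div_of_le (Real.rpow_pos_of_pos hk.1 _)
            (Real.rpow_le_rpow hk.1.le hd S.exponent_pos.le)
        rw [inv_mul_le_iff₀ S.Λ_pos]
        exact h3.trans hk.2.1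
    _ = ∫⁻ z in Ω ×ˢ N, ‖pairDiff w z‖ₑ ^ p ∂(kernelMeasure K) :=
        (setLIntegral_kernelMeasure S.kernel (S.isOpen.measurableSet.prod hNm)
          (enorm_pairDiff_aemeasurable hwm p)).symm
    _ ≤ _ := lintegral_mono_set hsub

end Setting

/-! ### Tails and the interaction of Ω with the complement of Ω'. -/

theorem lintegral_tail_lt_top (hp : 1 < p) {f : E n → ℝ} (hf : MemTailSpace s p f) (z : E n)
    {r : ℝ} (hr : 0 < r) :
    ∫⁻ x in (Metric.ball z r)ᶜ,
      ENNReal.ofReal (|f x| ^ (p - 1) * ‖x - z‖ ^ (-(n : ℝ) - s * p)) < ⊤ := by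
  have h := hf.2 z r hr
  rw [tail, ENNReal.rpow_lt_top_iff_of_pos (one_div_pos.2 (by linarith))] at h
  exact ENNReal.lt_top_of_mul_ne_top_right h.ne (by simp; positivity)

theorem lintegral_norm_rpow_compl_ball_lt_top (hsp : 0 < s * p) (z : E n) {r : ℝ} (hr : 0 < r) :
    ∫⁻ x in (Metric.ball z r)ᶜ, ENNReal.ofReal (‖x - z‖ ^ (-(n : ℝ) - s * p)) < ⊤ := by
  have hi : Integrable (fun x : E n => (1 + ‖x - z‖) ^ (-((n : ℝ) + s * p))) volume :=
    (integrable_one_add_norm (by simpa using hsp)).comp_sub_right z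
  have hi' := (hi.const_mul ((1 + r⁻¹) ^ ((n : ℝ) + s * p))).lintegral_lt_top
  refine lt_of_le_of_lt ?_ hi'
  refine le_trans (setLIntegral_mono' Metric.isOpen_ball.measurableSet.compl fun x hx => ?_)
    (setLIntegral_le_lintegral _ _)
  refine ENNReal.ofReal_le_ofReal ?_
  have hxr : r ≤ ‖x - z‖ := by
    simpa [Metric.mem_ball, dist_eq_norm] using hx
  have hpos : 0 < ‖x - z‖ := hr.trans_le hxr
  rw [show -(n : ℝ) - s * p = -((n : ℝ) + s * p) by ring, Real.rpow_neg hpos.le,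
    Real.rpow_neg (by positivity), ← div_eq_mul_inv, ← Real.div_rpow (by positivity) (by positivity),
    ← Real.inv_rpow hpos.le]
  refine Real.rpow_le_rpow (by positivity) ?_ (by positivity)
  rw [le_div_iff₀ (by positivity), inv_mul_le_iff₀ hpos]
  have : r⁻¹ * r ≤ r⁻¹ * ‖x - z‖ := by gcongr
  rw [inv_mul_cancel₀ hr.ne'] at this
  linarith

namespace Setting

/-- A majorant for the kernel on `Ω × Ω'ᶜ` that depends on the second variable only. -/
theorem exists_far_weight (S : Setting s p Λ K Ω Ω') : ∃ m : E n → ℝ≥0∞, Measurable m ∧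
    (∀ᵐ z : E n × E n, z.1 ∈ Ω → z.2 ∉ Ω' → ENNReal.ofReal (K z.1 z.2) ≤ m z.2) ∧
    (∫⁻ y in Ω'ᶜ, m y < ⊤) ∧
    ∀ f : E n → ℝ, MemTailSpace s p f → ∫⁻ y in Ω'ᶜ, ‖f y‖ₑ ^ (p - 1) * m y < ⊤ := by
  rcases Ω.eq_empty_or_nonempty with h0 | ⟨z₀, hz₀⟩
  · exact ⟨0, measurable_const, ae_of_all _ fun z hz => by simp [h0] at hz, by simp,
      fun f _ => by simp⟩
  have hp := S.one_lt_p
  -- Compact containment keeps Ω at distance at least d from the complement of Ω'.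
  obtain ⟨d, hd0, hd⟩ := S.contained.1.exists_thickening_subset_open S.isOpen' S.contained.2
  obtain ⟨R, hR0, hR⟩ := S.isBounded'.exists_pos_norm_le
  have hdist : ∀ x ∈ Ω, ∀ y, y ∉ Ω' → d ≤ ‖x - y‖ := fun x hx y hy => by
    by_contra hc
    refine hy (hd (Metric.mem_thickening_iff.2 ⟨x, subset_closure hx, ?_⟩))
    rw [dist_comm, dist_eq_norm]
    exact not_le.1 hc
  have hsub : Ω'ᶜ ⊆ (Metric.ball z₀ d)ᶜ := fun y hy h => by
    have := hdist z₀ hz₀ y hy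
    rw [Metric.mem_ball, dist_comm, dist_eq_norm] at h
    linarith
  -- From |y - z₀| ≤ |x - y| + 2R and |x - y| ≥ d follows |y - z₀| ≤ κ|x - y|, which freezes x at z₀
  -- in the kernel bound.
  set κ : ℝ := 1 + 2 * R / d
  have hκ : 0 < κ := by positivity
  set c : ℝ := Λ * κ ^ ((n : ℝ) + s * p)
  have hc0 : 0 ≤ c := mul_nonneg S.Λ_pos.le (by positivity)
  refine ⟨fun y => ENNReal.ofReal c * ENNReal.ofReal (‖y - z₀‖ ^ (-(n : ℝ) - s * p)),
    by fun_prop, ?_, ?_, fun f hf => ?_⟩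
  · filter_upwards [S.ae_kernel] with z hz h1 h2
    rw [← ENNReal.ofReal_mul hc0]
    refine ENNReal.ofReal_le_ofReal (hz.2.2.trans ?_)
    rw [mul_assoc]
    refine mul_le_mul_of_nonneg_left ?_ S.Λ_pos.le
    have hyz : 0 < ‖z.2 - z₀‖ := by
      have := hdist z₀ hz₀ z.2 h2
      rw [norm_sub_rev] at this
      linarith
    have hle : ‖z.2 - z₀‖ ≤ κ * ‖z.1 - z.2‖ := by
      have h3 : ‖z.2 - z₀‖ ≤ ‖z.1 - z.2‖ + ‖z.1 - z₀‖ := by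
        rw [norm_sub_rev z.1 z.2]
        exact norm_sub_le_norm_sub_add_norm_sub _ _ _
      have h4 : ‖z.1 - z₀‖ ≤ 2 * R := by
        have := hR _ (S.subset h1)
        have := hR _ (S.subset hz₀)
        linarith [norm_sub_le z.1 z₀]
      have h5 : 2 * R ≤ 2 * R / d * ‖z.1 - z.2‖ := by
        rw [div_mul_eq_mul_div, le_div_iff₀ hd0]
        exact mul_le_mul_of_nonneg_left (hdist _ h1 _ h2) (by positivity)
      linarith
    rw [show -(n : ℝ) - s * p = -((n : ℝ) + s * p) by ring, Real.rpow_neg hyz.le, ← div_eq_mul_inv,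
      ← Real.div_rpow hκ.le hyz.le, one_div, ← Real.inv_rpow hz.1.le]
    refine Real.rpow_le_rpow (by positivity) ?_ S.exponent_pos.le
    rwa [le_div_iff₀ hyz, inv_mul_le_iff₀ hz.1, mul_comm]
  · rw [lintegral_const_mul' _ _ ENNReal.ofReal_ne_top]
    exact ENNReal.mul_lt_top ENNReal.ofReal_lt_top ((lintegral_mono_set hsub).trans_lt
      (lintegral_norm_rpow_compl_ball_lt_top (mul_pos S.s_pos (by linarith)) z₀ hd0))
  · have heq : ∀ y, ‖f y‖ₑ ^ (p - 1) * (ENNReal.ofReal c * ENNReal.ofReal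
        (‖y - z₀‖ ^ (-(n : ℝ) - s * p))) = ENNReal.ofReal c *
        ENNReal.ofReal (|f y| ^ (p - 1) * ‖y - z₀‖ ^ (-(n : ℝ) - s * p)) := fun y => by
      have h0 : 0 ≤ |f y| ^ (p - 1) := by positivity
      rw [ENNReal.ofReal_mul h0, ofReal_abs_rpow (by linarith)]
      ring
    simp_rw [heq]
    rw [lintegral_const_mul' _ _ ENNReal.ofReal_ne_top]
    exact ENNReal.mul_lt_top ENNReal.ofReal_lt_top ((lintegral_mono_set hsub).trans_lt
      (lintegral_tail_lt_top hp hf z₀ hd0))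

/-- Once the kernel is replaced by a weight in y alone, the double integral factors. -/
theorem lintegral_far_le (S : Setting s p Λ K Ω Ω') {m : E n → ℝ≥0∞} (hm : Measurable m)
    (hKm : ∀ᵐ z : E n × E n, z.1 ∈ Ω → z.2 ∉ Ω' → ENNReal.ofReal (K z.1 z.2) ≤ m z.2)
    {F H : E n → ℝ≥0∞} (hF : AEMeasurable F volume) (hH : AEMeasurable H volume) :
    ∫⁻ z in Ω ×ˢ Ω'ᶜ, F z.1 * H z.2 ∂(kernelMeasure K) ≤
      (∫⁻ x in Ω, F x) * ∫⁻ y in Ω'ᶜ, H y * m y := by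
  have hS := S.isOpen.measurableSet.prod S.isOpen'.measurableSet.compl
  have hFH : AEMeasurable (fun z : E n × E n => F z.1 * H z.2) volume :=
    (hF.comp_quasiMeasurePreserving Measure.quasiMeasurePreserving_fst).mul
      (hH.comp_quasiMeasurePreserving Measure.quasiMeasurePreserving_snd)
  have hvol : (volume : Measure (E n × E n)).restrict (Ω ×ˢ Ω'ᶜ) =
      (volume.restrict Ω).prod (volume.restrict Ω'ᶜ) := by
    rw [Measure.prod_restrict]; rfl
  rw [setLIntegral_kernelMeasure S.kernel hS hFH, ← lintegral_prod_mul hF.restrict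
    (g := fun y => H y * m y) (hH.mul hm.aemeasurable).restrict, ← hvol]
  refine lintegral_mono_ae ?_
  filter_upwards [ae_restrict_mem hS, ae_restrict_of_ae hKm] with z hz hk
  rw [mul_comm, mul_assoc]
  gcongr
  exact hk hz.1 hz.2

/-- A pair outside Ω' × Ω' either joins Ω to the complement of Ω', in one of two orders exchanged by
symmetry, or has both points outside Ω, where the integrand vanishes. -/
theorem lintegral_le_near_add_far (S : Setting s p Λ K Ω Ω') {f : E n × E n → ℝ≥0∞}
    (hf : AEMeasurable f volume) (hsymm : ∀ x y, f (x, y) = f (y, x))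
    (hzero : ∀ᵐ z : E n × E n, z.1 ∉ Ω → z.2 ∉ Ω → f z = 0) :
    ∫⁻ z, f z ∂(kernelMeasure K) ≤ ∫⁻ z in Ω' ×ˢ Ω', f z ∂(kernelMeasure K) +
      2 * ∫⁻ z in Ω ×ˢ Ω'ᶜ, f z ∂(kernelMeasure K) := by
  have hΩ := S.isOpen.measurableSet
  have hΩ' := S.isOpen'.measurableSet
  have hcov : (Set.univ : Set (E n × E n)) ⊆
      ((Ω' ×ˢ Ω') ∪ ((Ω ×ˢ Ω'ᶜ) ∪ (Ω'ᶜ ×ˢ Ω))) ∪ (Ωᶜ ×ˢ Ωᶜ) := by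
    rintro ⟨x, y⟩ -
    have h1 : x ∈ Ω → x ∈ Ω' := fun h => S.subset h
    have h2 : y ∈ Ω → y ∈ Ω' := fun h => S.subset h
    simp only [Set.mem_union, Set.mem_prod, Set.mem_compl_iff]
    tauto
  have h0 : ∫⁻ z in Ωᶜ ×ˢ Ωᶜ, f z ∂(kernelMeasure K) = 0 := by
    have : ∀ᵐ z ∂(kernelMeasure K).restrict (Ωᶜ ×ˢ Ωᶜ), f z = 0 := by
      filter_upwards [ae_restrict_mem (hΩ.compl.prod hΩ.compl),
        ae_restrict_of_ae (kernelMeasure_absolutelyContinuous.ae_le hzero)] with z hz h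
      exact h hz.1 hz.2
    rw [lintegral_congr_ae this, lintegral_zero]
  calc ∫⁻ z, f z ∂(kernelMeasure K) = ∫⁻ z in Set.univ, f z ∂(kernelMeasure K) := by simp
    _ ≤ _ := lintegral_mono_set hcov
    _ ≤ _ := lintegral_union_le _ _ _
    _ ≤ (∫⁻ z in Ω' ×ˢ Ω', f z ∂(kernelMeasure K) + (∫⁻ z in Ω ×ˢ Ω'ᶜ, f z ∂(kernelMeasure K) +
          ∫⁻ z in Ω'ᶜ ×ˢ Ω, f z ∂(kernelMeasure K))) + 0 := by
        rw [h0]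
        gcongr
        exact (lintegral_union_le _ _ _).trans (add_le_add le_rfl (lintegral_union_le _ _ _))
    _ = _ := by
        rw [setLIntegral_kernelMeasure_swap S.kernel hΩ'.compl hΩ hf hsymm, add_zero, two_mul]

/-- In the far region the increment is w(x) alone, so Poincaré closes the estimate. -/
theorem exists_lintegral_rpow_le (S : Setting s p Λ K Ω Ω') : ∃ C : ℝ≥0∞, C ≠ ⊤ ∧
    ∀ w : E n → ℝ, AEStronglyMeasurable w volume → (∀ᵐ x, x ∉ Ω → w x = 0) →
    ∫⁻ z, ‖pairDiff w z‖ₑ ^ p ∂(kernelMeasure K) ≤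
      C * ∫⁻ z in Ω' ×ˢ Ω', ‖pairDiff w z‖ₑ ^ p ∂(kernelMeasure K) := by
  have hp0 : 0 < p := by linarith [S.one_lt_p]
  obtain ⟨C, hC, hP⟩ := S.exists_poincare
  obtain ⟨m, hm, hKm, hmi, -⟩ := S.exists_far_weight
  refine ⟨1 + 2 * (C * ∫⁻ y in Ω'ᶜ, m y), ENNReal.add_ne_top.2 ⟨by simp, ENNReal.mul_ne_top (by simp)
    (ENNReal.mul_ne_top hC hmi.ne)⟩, fun w hwm hw => ?_⟩
  have hS := S.isOpen.measurableSet.prod S.isOpen'.measurableSet.compl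
  have h1 := S.lintegral_le_near_add_far (enorm_pairDiff_aemeasurable hwm p)
    (fun x y => by simp only [pairDiff]; rw [enorm_sub_rev]) (by
      filter_upwards [ae_fst_and_snd hw] with z hz h1 h2
      simp [pairDiff, hz.1 h1, hz.2 h2, hp0])
  have h2 : ∫⁻ z in Ω ×ˢ Ω'ᶜ, ‖pairDiff w z‖ₑ ^ p ∂(kernelMeasure K) ≤
      (∫⁻ x, ‖w x‖ₑ ^ p) * ∫⁻ y in Ω'ᶜ, m y := by
    have h3 := S.lintegral_far_le hm hKm (F := fun x => ‖w x‖ₑ ^ p) (H := fun _ => 1)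
      (hwm.enorm.pow_const p) aemeasurable_const
    simp only [mul_one, one_mul] at h3
    refine le_trans (le_of_eq ?_) (h3.trans (mul_le_mul_left (setLIntegral_le_lintegral _ _) _))
    refine lintegral_congr_ae ?_
    filter_upwards [ae_restrict_mem hS, ae_restrict_of_ae
      (kernelMeasure_absolutelyContinuous.ae_le (ae_fst_and_snd hw))] with z hz hwz
    rw [pairDiff, hwz.2 fun h => hz.2 (S.subset h), sub_zero]
  refine h1.trans ?_
  set N := ∫⁻ z in Ω' ×ˢ Ω', ‖pairDiff w z‖ₑ ^ p ∂(kernelMeasure K)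
  calc N + 2 * ∫⁻ z in Ω ×ˢ Ω'ᶜ, ‖pairDiff w z‖ₑ ^ p ∂(kernelMeasure K)
      ≤ N + 2 * (C * N * ∫⁻ y in Ω'ᶜ, m y) := by
        gcongr
        exact h2.trans (mul_le_mul_left (hP w hwm hw) _)
    _ = _ := by ring

/-- Hölder settles the near part. In the far part |u(x) - u(y)|^(p-1) is split: the x-term pairs
with w by Hölder on Ω, and the y-term is a finite tail of g multiplied by the L¹ norm of w. -/
theorem exists_lintegral_dual_le (S : Setting s p Λ K Ω Ω') {g u : E n → ℝ}
    (hg : MemTailSpace s p g) (hum : AEStronglyMeasurable u volume) (hu : MemW s p Ω' u)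
    (hug : ∀ᵐ x, x ∉ Ω → u x = g x) : ∃ C : ℝ≥0∞, C ≠ ⊤ ∧
    ∀ w : E n → ℝ, AEStronglyMeasurable w volume → (∀ᵐ x, x ∉ Ω → w x = 0) →
    ∫⁻ z, ‖pairDiff u z‖ₑ ^ (p - 1) * ‖pairDiff w z‖ₑ ∂(kernelMeasure K) ≤
      C * (∫⁻ z in Ω' ×ˢ Ω', ‖pairDiff w z‖ₑ ^ p ∂(kernelMeasure K)) ^ (1 / p) := by
  have hp := S.one_lt_p
  have hp0 : 0 < p := by linarith
  obtain ⟨C, hC, hP⟩ := S.exists_poincare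
  obtain ⟨m, hm, hKm, hmi, hmt⟩ := S.exists_far_weight
  have hut : ∫⁻ y in Ω'ᶜ, ‖u y‖ₑ ^ (p - 1) * m y < ⊤ := by
    refine lt_of_le_of_lt (le_of_eq (lintegral_congr_ae ?_)) (hmt g hg)
    filter_upwards [ae_restrict_mem S.isOpen'.measurableSet.compl, ae_restrict_of_ae hug] with y hy h
    rw [h fun h' => hy (S.subset h')]
  obtain ⟨hu1, hu2⟩ := (S.memW_iff hum).1 hu
  have hU1 := lintegral_enorm_rpow_lt_top_of_memLp hp0 (hu1.mono_measure
    (Measure.restrict_mono S.subset le_rfl))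
  have hU2 := lintegral_enorm_rpow_lt_top_of_memLp hp0 hu2
  have hΩfin : volume Ω < ⊤ := (S.isBounded'.subset S.subset).measure_lt_top
  have hq : (0 : ℝ) ≤ 1 / p.conjExponent := by
    have := (Real.HolderConjugate.conjExponent hp).symm.pos
    positivity
  set A₁ := (∫⁻ z in Ω' ×ˢ Ω', ‖pairDiff u z‖ₑ ^ p ∂(kernelMeasure K)) ^ (1 / p.conjExponent)
  set A₂ := (∫⁻ x in Ω, ‖u x‖ₑ ^ p) ^ (1 / p.conjExponent)
  set A₃ := (volume Ω) ^ (1 / p.conjExponent)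
  set T := ENNReal.ofReal (2 ^ (p - 1)) *
    (A₂ * (∫⁻ y in Ω'ᶜ, m y) + A₃ * ∫⁻ y in Ω'ᶜ, ‖u y‖ₑ ^ (p - 1) * m y)
  have hT : T ≠ ⊤ := ENNReal.mul_ne_top ENNReal.ofReal_ne_top (ENNReal.add_ne_top.2
    ⟨ENNReal.mul_ne_top (ENNReal.rpow_ne_top_of_nonneg hq hU1.ne) hmi.ne,
      ENNReal.mul_ne_top (ENNReal.rpow_ne_top_of_nonneg hq hΩfin.ne) hut.ne⟩)
  refine ⟨A₁ + 2 * (T * C ^ (1 / p)), ENNReal.add_ne_top.2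
    ⟨ENNReal.rpow_ne_top_of_nonneg hq hU2.ne, ENNReal.mul_ne_top (by simp)
      (ENNReal.mul_ne_top hT (ENNReal.rpow_ne_top_of_nonneg (by positivity) hC))⟩,
    fun w hwm hw => ?_⟩
  have hS := S.isOpen.measurableSet.prod S.isOpen'.measurableSet.compl
  have hDw : AEMeasurable (fun z => ‖pairDiff w z‖ₑ) (volume : Measure (E n × E n)) :=
    (pairDiff_aestronglyMeasurable hwm).enorm
  have hDu : AEMeasurable (fun z => ‖pairDiff u z‖ₑ) (volume : Measure (E n × E n)) :=
    (pairDiff_aestronglyMeasurable hum).enorm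
  have h1 := S.lintegral_le_near_add_far ((enorm_pairDiff_aemeasurable hum (p - 1)).mul hDw)
    (fun x y => by
      simp only [pairDiff, Pi.mul_apply]; rw [enorm_sub_rev, enorm_sub_rev (w x)]) (by
      filter_upwards [ae_fst_and_snd hw] with z hz h1 h2
      simp [pairDiff, hz.1 h1, hz.2 h2])
  simp only [Pi.mul_apply] at h1
  refine h1.trans ?_
  set N := ∫⁻ z in Ω' ×ˢ Ω', ‖pairDiff w z‖ₑ ^ p ∂(kernelMeasure K)
  have hnear : ∫⁻ z in Ω' ×ˢ Ω', ‖pairDiff u z‖ₑ ^ (p - 1) * ‖pairDiff w z‖ₑ ∂(kernelMeasure K) ≤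
      A₁ * N ^ (1 / p) :=
    lintegral_rpow_mul_le _ hp (hDu.mono_ac kernelMeasure_absolutelyContinuous).restrict
      (hDw.mono_ac kernelMeasure_absolutelyContinuous).restrict
  have hW : (∫⁻ x in Ω, ‖w x‖ₑ ^ p) ^ (1 / p) ≤ C ^ (1 / p) * N ^ (1 / p) := by
    rw [← ENNReal.mul_rpow_of_nonneg _ _ (by positivity)]
    exact ENNReal.rpow_le_rpow ((setLIntegral_le_lintegral _ _).trans (hP w hwm hw))
      (by positivity)
  have hh1 : ∫⁻ x in Ω, ‖u x‖ₑ ^ (p - 1) * ‖w x‖ₑ ≤ A₂ * (C ^ (1 / p) * N ^ (1 / p)) :=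
    (lintegral_rpow_mul_le _ hp hum.enorm.restrict hwm.enorm.restrict).trans
      (mul_le_mul_right hW _)
  have hh2 : ∫⁻ x in Ω, ‖w x‖ₑ ≤ A₃ * (C ^ (1 / p) * N ^ (1 / p)) := by
    -- Hölder against the constant 1 on the bounded set Ω.
    have := (lintegral_rpow_mul_le (volume.restrict Ω) hp (f := fun _ => 1) aemeasurable_const
      hwm.enorm.restrict).trans (mul_le_mul_right hW _)
    simpa [A₃] using this
  have hfar : ∫⁻ z in Ω ×ˢ Ω'ᶜ, ‖pairDiff u z‖ₑ ^ (p - 1) * ‖pairDiff w z‖ₑ ∂(kernelMeasure K) ≤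
      T * (C ^ (1 / p) * N ^ (1 / p)) := by
    have hF1 : AEMeasurable (fun x => ‖u x‖ₑ ^ (p - 1) * ‖w x‖ₑ) volume :=
      (hum.enorm.pow_const _).mul hwm.enorm
    have e1 := S.lintegral_far_le hm hKm (H := fun _ => 1) hF1 aemeasurable_const
    have e2 := S.lintegral_far_le hm hKm hwm.enorm (hum.enorm.pow_const (p - 1))
    simp only [mul_one, one_mul] at e1
    calc ∫⁻ z in Ω ×ˢ Ω'ᶜ, ‖pairDiff u z‖ₑ ^ (p - 1) * ‖pairDiff w z‖ₑ ∂(kernelMeasure K)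
        ≤ ∫⁻ z in Ω ×ˢ Ω'ᶜ, ENNReal.ofReal (2 ^ (p - 1)) * (‖u z.1‖ₑ ^ (p - 1) * ‖w z.1‖ₑ +
            ‖w z.1‖ₑ * ‖u z.2‖ₑ ^ (p - 1)) ∂(kernelMeasure K) := by
          refine lintegral_mono_ae ?_
          filter_upwards [ae_restrict_mem hS, ae_restrict_of_ae
            (kernelMeasure_absolutelyContinuous.ae_le (ae_fst_and_snd hw))] with z hz hwz
          simp only [pairDiff]
          rw [hwz.2 fun h => hz.2 (S.subset h), sub_zero]
          refine (mul_le_mul_left (enorm_sub_rpow_le (by linarith) _ _) _).trans (le_of_eq ?_)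
          ring
      _ = ENNReal.ofReal (2 ^ (p - 1)) *
          (∫⁻ z in Ω ×ˢ Ω'ᶜ, ‖u z.1‖ₑ ^ (p - 1) * ‖w z.1‖ₑ ∂(kernelMeasure K) +
            ∫⁻ z in Ω ×ˢ Ω'ᶜ, ‖w z.1‖ₑ * ‖u z.2‖ₑ ^ (p - 1) ∂(kernelMeasure K)) := by
          rw [lintegral_const_mul' _ _ ENNReal.ofReal_ne_top, lintegral_add_left']
          exact ((hF1.comp_quasiMeasurePreserving Measure.quasiMeasurePreserving_fst).mono_ac
            kernelMeasure_absolutelyContinuous).restrict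
      _ ≤ ENNReal.ofReal (2 ^ (p - 1)) * (A₂ * (C ^ (1 / p) * N ^ (1 / p)) * (∫⁻ y in Ω'ᶜ, m y) +
            A₃ * (C ^ (1 / p) * N ^ (1 / p)) * ∫⁻ y in Ω'ᶜ, ‖u y‖ₑ ^ (p - 1) * m y) := by
          gcongr
          · exact e1.trans (mul_le_mul_left hh1 _)
          · exact e2.trans (mul_le_mul_left hh2 _)
      _ = _ := by ring
  calc _ ≤ A₁ * N ^ (1 / p) + 2 * (T * (C ^ (1 / p) * N ^ (1 / p))) := by gcongr
    _ = _ := by ring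

end Setting

end

end FracObstacle

end
noncomputable section

namespace FracObstacle

open Filter Topology

/-! ### The obstacle class -/

section

variable {n : ℕ} {s p Λ : ℝ} {K : E n → E n → ℝ} {Ω Ω' : Set (E n)} {g : E n → ℝ}
  {h : E n → EReal}

theorem MemTailSpace.aestronglyMeasurable (hg : MemTailSpace s p g) :
    AEStronglyMeasurable g volume := by
  have := (aestronglyMeasurable_iUnion_iff (μ := (volume : Measure (E n))) (f := g)
    (s := fun k : ℕ => Metric.closedBall (0 : E n) k)).2
    fun k => (hg.1 _ (isCompact_closedBall _ _)).1
  rwa [Metric.iUnion_closedBall_nat, Measure.restrict_univ] at this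

namespace Setting

theorem mem_obstacleClass_iff (S : Setting s p Λ K Ω Ω') {u : E n → ℝ} :
    u ∈ obstacleClass s p g h Ω Ω' ↔ MemW s p Ω' u ∧ (∀ᵐ x, x ∈ Ω → h x ≤ (u x : EReal)) ∧
      ∀ᵐ x, x ∉ Ω → u x = g x := by
  rw [obstacleClass, Set.mem_ofPred_eq, ae_restrict_iff' S.isOpen.measurableSet,
    ae_restrict_iff' S.isOpen.measurableSet.compl]
  rfl

theorem aestronglyMeasurable_of_mem (S : Setting s p Λ K Ω Ω')
    (hg : AEStronglyMeasurable g volume) {u : E n → ℝ} (hu : u ∈ obstacleClass s p g h Ω Ω') :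
    AEStronglyMeasurable u volume := by
  have h1 : AEStronglyMeasurable u (volume.restrict Ω) :=
    hu.1.1.1.mono_measure (Measure.restrict_mono S.subset le_rfl)
  have h2 : AEStronglyMeasurable u (volume.restrict Ωᶜ) := hg.restrict.congr (EventuallyEq.symm hu.2.2)
  have := aestronglyMeasurable_union_iff.2 ⟨h1, h2⟩
  rwa [Set.union_compl_self, Measure.restrict_univ] at this

theorem ae_sub_eq_zero (S : Setting s p Λ K Ω Ω') {u v : E n → ℝ}
    (hu : u ∈ obstacleClass s p g h Ω Ω') (hv : v ∈ obstacleClass s p g h Ω Ω') :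
    ∀ᵐ x, x ∉ Ω → (v - u) x = 0 := by
  filter_upwards [(S.mem_obstacleClass_iff.1 hu).2.2, (S.mem_obstacleClass_iff.1 hv).2.2]
    with x h1 h2 hx
  rw [Pi.sub_apply, h1 hx, h2 hx, sub_self]

theorem pairDiff_sub (u v : E n → ℝ) : pairDiff (v - u) = pairDiff v - pairDiff u := by
  ext z; simp only [pairDiff, Pi.sub_apply]; ring

theorem memLp_pairDiff_sub (S : Setting s p Λ K Ω Ω') (hg : AEStronglyMeasurable g volume)
    {u v : E n → ℝ} (hu : u ∈ obstacleClass s p g h Ω Ω')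
    (hv : v ∈ obstacleClass s p g h Ω Ω') :
    MemLp (pairDiff (v - u)) (ENNReal.ofReal p) ((kernelMeasure K).restrict (Ω' ×ˢ Ω')) := by
  rw [pairDiff_sub]
  exact ((S.memW_iff (S.aestronglyMeasurable_of_mem hg hv)).1 hv.1).2.sub
    ((S.memW_iff (S.aestronglyMeasurable_of_mem hg hu)).1 hu.1).2

theorem convex_mem (S : Setting s p Λ K Ω Ω') (hg : AEStronglyMeasurable g volume)
    {u v : E n → ℝ} (hu : u ∈ obstacleClass s p g h Ω Ω')
    (hv : v ∈ obstacleClass s p g h Ω Ω') {t : ℝ} (ht0 : 0 ≤ t) (ht1 : t ≤ 1) :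
    (fun x => u x + t * (v x - u x)) ∈ obstacleClass s p g h Ω Ω' := by
  have hum := S.aestronglyMeasurable_of_mem hg hu
  have hvm := S.aestronglyMeasurable_of_mem hg hv
  obtain ⟨hu1, hu2⟩ := (S.memW_iff hum).1 hu.1
  obtain ⟨hv1, hv2⟩ := (S.memW_iff hvm).1 hv.1
  refine S.mem_obstacleClass_iff.2 ⟨(S.memW_iff (hum.add ((hvm.sub hum).const_mul t))).2
    ⟨hu1.add ((hv1.sub hu1).const_mul t), ?_⟩, ?_, ?_⟩
  · convert hu2.add ((hv2.sub hu2).const_mul t) using 1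
    ext z; simp only [pairDiff, Pi.add_apply, Pi.sub_apply]; ring
  · filter_upwards [(S.mem_obstacleClass_iff.1 hu).2.1, (S.mem_obstacleClass_iff.1 hv).2.1]
      with x h1 h2 hx
    -- Comparing with the smaller of the two values avoids any arithmetic with the extended-real
    -- obstacle.
    have hmin : min (u x) (v x) ≤ u x + t * (v x - u x) := by
      rcases le_total (u x) (v x) with hle | hle
      · rw [min_eq_left hle]; nlinarith
      · rw [min_eq_right hle]; nlinarith
    refine le_trans ?_ (EReal.coe_le_coe_iff.2 hmin)
    rcases min_choice (u x) (v x) with e | e <;> rw [e]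
    exacts [h1 hx, h2 hx]
  · filter_upwards [(S.mem_obstacleClass_iff.1 hu).2.2, (S.mem_obstacleClass_iff.1 hv).2.2]
      with x h1 h2 hx
    rw [h1 hx, h2 hx]; ring

theorem exists_eLpNorm_le (S : Setting s p Λ K Ω Ω') : ∃ C : ℝ≥0∞, C ≠ ⊤ ∧ ∀ w : E n → ℝ,
    AEStronglyMeasurable w volume → (∀ᵐ x, x ∉ Ω → w x = 0) →
    eLpNorm w (ENNReal.ofReal p) volume ≤
      C * eLpNorm (pairDiff w) (ENNReal.ofReal p) ((kernelMeasure K).restrict (Ω' ×ˢ Ω')) := by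
  have hp0 : 0 < p := by linarith [S.one_lt_p]
  obtain ⟨C, hC, hP⟩ := S.exists_poincare
  refine ⟨C ^ (1 / p), ENNReal.rpow_ne_top_of_nonneg (by positivity) hC, fun w hwm hw => ?_⟩
  rw [eLpNorm_eq_lintegral_rpow_enorm_toReal (by simpa using hp0) ENNReal.ofReal_ne_top,
    eLpNorm_eq_lintegral_rpow_enorm_toReal (by simpa using hp0) ENNReal.ofReal_ne_top,
    ENNReal.toReal_ofReal hp0.le, ← ENNReal.mul_rpow_of_nonneg _ _ (by positivity)]
  exact ENNReal.rpow_le_rpow (hP w hwm hw) (by positivity)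

/-- Sequences in the obstacle class that are Cauchy for the Gagliardo seminorm on `Ω'` converge
in the class. -/
theorem obstacleClass_complete (S : Setting s p Λ K Ω Ω') (hg : AEStronglyMeasurable g volume)
    {u : ℕ → E n → ℝ} (hu : ∀ k, u k ∈ obstacleClass s p g h Ω Ω')
    (hcau : ∀ N k m, N ≤ k → N ≤ m → eLpNorm (pairDiff (u k) - pairDiff (u m)) (ENNReal.ofReal p)
      ((kernelMeasure K).restrict (Ω' ×ˢ Ω')) < 2⁻¹ ^ N) :
    ∃ v ∈ obstacleClass s p g h Ω Ω', Tendsto (fun k => eLpNorm (pairDiff (u k) - pairDiff v)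
      (ENNReal.ofReal p) ((kernelMeasure K).restrict (Ω' ×ˢ Ω'))) atTop (𝓝 0) := by
  have hp := S.one_lt_p
  have hp1 : (1 : ℝ≥0∞) ≤ ENNReal.ofReal p := by simpa using hp.le
  have hp0 : ENNReal.ofReal p ≠ 0 := (one_pos.trans_le hp1).ne'
  set ν := (kernelMeasure K).restrict (Ω' ×ˢ Ω')
  have hνac : ν ≪ volume :=
    Measure.restrict_le_self.absolutelyContinuous.trans kernelMeasure_absolutelyContinuous
  have hum := fun k => S.aestronglyMeasurable_of_mem hg (hu k)
  have hsumB : ∑' i : ℕ, (2⁻¹ : ℝ≥0∞) ^ i ≠ ⊤ := by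
    rw [ENNReal.tsum_geometric]
    simp
  obtain ⟨F, hF, hFlim⟩ := Lp.cauchy_complete_eLpNorm hp1
    (fun k => ((S.memW_iff (hum k)).1 (hu k).1).2) hsumB hcau
  obtain ⟨C, hC, hP⟩ := S.exists_eLpNorm_le
  have hPu : ∀ k m, eLpNorm (u k - u m) (ENNReal.ofReal p) volume ≤
      C * eLpNorm (pairDiff (u k) - pairDiff (u m)) (ENNReal.ofReal p) ν := fun k m => by
    rw [← pairDiff_sub]
    exact hP _ ((hum k).sub (hum m)) (S.ae_sub_eq_zero (hu m) (hu k))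
  -- The u k need not lie in L^p of the whole space; their differences do, since they vanish off Ω.
  have hmem : ∀ k, MemLp (u k - u 0) (ENNReal.ofReal p) volume := fun k =>
    ⟨(hum k).sub (hum 0), (hPu k 0).trans_lt (ENNReal.mul_lt_top hC.lt_top
      (pairDiff_sub (u 0) (u k) ▸ (S.memLp_pairDiff_sub hg (hu 0) (hu k)).2))⟩
  obtain ⟨w, hw, hwlim⟩ := Lp.cauchy_complete_eLpNorm hp1 hmem
    -- The summand 1 in C + 1 provides the strict inequality required of the Cauchy bound.
    (B := fun N => (C + 1) * 2⁻¹ ^ N)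
    (by rw [ENNReal.tsum_mul_left]; exact ENNReal.mul_ne_top (by simp [hC]) hsumB)
    (by
      intro N k m hk hm
      have e : u k - u 0 - (u m - u 0) = u k - u m := by abel
      rw [e]
      have hfin : (2⁻¹ : ℝ≥0∞) ^ N ≠ ⊤ := ENNReal.pow_ne_top (by simp)
      refine ((hPu k m).trans (mul_le_mul_right (hcau N k m hk hm).le C)).trans_lt ?_
      rw [add_mul, one_mul]
      exact ENNReal.lt_add_right (ENNReal.mul_ne_top hC hfin)
        (pow_ne_zero _ (by simp)))
  obtain ⟨ns, hns, hae⟩ := (tendstoInMeasure_of_tendsto_eLpNorm hp0 (fun k => (hmem k).1) hw.1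
    hwlim).exists_seq_tendsto_ae
  obtain ⟨ms, hms, hae'⟩ := (tendstoInMeasure_of_tendsto_eLpNorm hp0
    (f := fun k => pairDiff (u (ns k))) (fun k =>
      ((S.memW_iff (hum (ns k))).1 (hu (ns k)).1).2.1) hF.1
    (hFlim.comp hns.tendsto_atTop)).exists_seq_tendsto_ae
  set v : E n → ℝ := u 0 + w
  have hvm : AEStronglyMeasurable v volume := (hum 0).add hw.1
  have hlimv : ∀ᵐ x, Tendsto (fun k => u (ns k) x) atTop (𝓝 (v x)) := by
    filter_upwards [hae] with x hx
    simpa [v] using hx.const_add (u 0 x)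
  -- Along a common subsequence u converges a.e. to v and the increments converge ν-a.e. to F, which
  -- identifies F with the increments of v.
  have hFv : F =ᵐ[ν] pairDiff v := by
    filter_upwards [hae', hνac.ae_le (ae_fst_and_snd hlimv)] with z h1 h2
    exact tendsto_nhds_unique h1 ((h2.1.sub h2.2).comp hms.tendsto_atTop)
  refine ⟨v, S.mem_obstacleClass_iff.2 ⟨(S.memW_iff hvm).2 ⟨?_, hF.ae_eq hFv⟩, ?_, ?_⟩, ?_⟩
  · exact (hu 0).1.1.add (hw.restrict _)
  · filter_upwards [hlimv, ae_all_iff.2 fun k => (S.mem_obstacleClass_iff.1 (hu k)).2.1]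
      with x h1 h2 hx
    exact ge_of_tendsto' ((continuous_coe_real_ereal.tendsto _).comp h1) fun k => h2 (ns k) hx
  · filter_upwards [hlimv, ae_all_iff.2 fun k => (S.mem_obstacleClass_iff.1 (hu k)).2.2]
      with x h1 h2 hx
    refine tendsto_nhds_unique h1 ?_
    simp only [fun k => h2 (ns k) hx]
    exact tendsto_const_nhds
  · refine hFlim.congr fun k => eLpNorm_congr_ae ?_
    filter_upwards [hFv] with z hz
    rw [Pi.sub_apply, Pi.sub_apply, hz]

theorem integrable_rpow_pairDiff (S : Setting s p Λ K Ω Ω') {w : E n → ℝ}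
    (hwm : AEStronglyMeasurable w volume) (hw : ∀ᵐ x, x ∉ Ω → w x = 0)
    (hwν : MemLp (pairDiff w) (ENNReal.ofReal p) ((kernelMeasure K).restrict (Ω' ×ˢ Ω'))) :
    Integrable (fun z => |pairDiff w z| ^ p) (kernelMeasure K) := by
  have hp0 : 0 < p := by linarith [S.one_lt_p]
  obtain ⟨C, hC, H⟩ := S.exists_lintegral_rpow_le
  have hm : MemLp (pairDiff w) (ENNReal.ofReal p) (kernelMeasure K) := by
    rw [memLp_iff_lintegral_enorm_rpow_lt_top hp0
      ((pairDiff_aestronglyMeasurable hwm).mono_ac kernelMeasure_absolutelyContinuous)]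
    exact (H w hwm hw).trans_lt (ENNReal.mul_lt_top hC.lt_top
      (lintegral_enorm_rpow_lt_top_of_memLp hp0 hwν))
  have := hm.integrable_norm_rpow (by simpa using hp0) ENNReal.ofReal_ne_top
  rwa [ENNReal.toReal_ofReal hp0.le] at this

theorem ofReal_integral_abs_rpow {X : Type*} [MeasurableSpace X] {μ : Measure X} {q : ℝ}
    (hq : 0 ≤ q) {f : X → ℝ} (hf : Integrable (fun x => |f x| ^ q) μ) :
    ENNReal.ofReal (∫ x, |f x| ^ q ∂μ) = ∫⁻ x, ‖f x‖ₑ ^ q ∂μ := by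
  rw [ofReal_integral_eq_lintegral_ofReal hf (ae_of_all _ fun x => by positivity)]
  simp_rw [ofReal_abs_rpow hq]

theorem exists_dual (S : Setting s p Λ K Ω Ω') (hg : MemTailSpace s p g) {u : E n → ℝ}
    (hu : u ∈ obstacleClass s p g h Ω Ω') : ∃ C : ℝ, ∀ w : E n → ℝ,
      AEStronglyMeasurable w volume → (∀ᵐ x, x ∉ Ω → w x = 0) →
      MemLp (pairDiff w) (ENNReal.ofReal p) ((kernelMeasure K).restrict (Ω' ×ˢ Ω')) →
      Integrable (fun z => |pairDiff u z| ^ (p - 1) * |pairDiff w z|) (kernelMeasure K) ∧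
      ∫ z, |pairDiff u z| ^ (p - 1) * |pairDiff w z| ∂(kernelMeasure K) ≤
        C * (∫ z in Ω' ×ˢ Ω', |pairDiff w z| ^ p ∂(kernelMeasure K)) ^ (1 / p) := by
  have hp := S.one_lt_p
  have hp0 : 0 < p := by linarith
  have hum := S.aestronglyMeasurable_of_mem hg.aestronglyMeasurable hu
  obtain ⟨C, hC, H⟩ := S.exists_lintegral_dual_le hg hum hu.1 (S.mem_obstacleClass_iff.1 hu).2.2
  refine ⟨C.toReal, fun w hwm hw hwν => ?_⟩
  have hle := H w hwm hw
  have hac := kernelMeasure_absolutelyContinuous (K := K)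
  have hum' := ((pairDiff_aestronglyMeasurable hum).mono_ac hac).aemeasurable
  have hwm' := ((pairDiff_aestronglyMeasurable hwm).mono_ac hac).aemeasurable
  have hmeas : AEStronglyMeasurable (fun z => |pairDiff u z| ^ (p - 1) * |pairDiff w z|)
      (kernelMeasure K) := AEMeasurable.aestronglyMeasurable (by fun_prop)
  have heq : ∀ z, ENNReal.ofReal (|pairDiff u z| ^ (p - 1) * |pairDiff w z|) =
      ‖pairDiff u z‖ₑ ^ (p - 1) * ‖pairDiff w z‖ₑ := fun z => by
    have h0 : 0 ≤ |pairDiff u z| ^ (p - 1) := by positivity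
    rw [ENNReal.ofReal_mul h0, ofReal_abs_rpow (by linarith), Real.enorm_eq_ofReal_abs
      (pairDiff w z)]
  have hwi := (S.integrable_rpow_pairDiff hwm hw hwν).restrict (s := Ω' ×ˢ Ω')
  have hpos : 0 ≤ ∫ z in Ω' ×ˢ Ω', |pairDiff w z| ^ p ∂(kernelMeasure K) :=
    integral_nonneg fun z => by positivity
  rw [← ofReal_integral_abs_rpow hp0.le hwi,
    ENNReal.ofReal_rpow_of_nonneg hpos (by positivity)] at hle
  have hfin : C * ENNReal.ofReal ((∫ z in Ω' ×ˢ Ω', |pairDiff w z| ^ p ∂(kernelMeasure K)) ^ (1 / p))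
    ≠ ⊤ := ENNReal.mul_ne_top hC ENNReal.ofReal_ne_top
  constructor
  · refine ⟨hmeas, (hasFiniteIntegral_iff_ofReal (ae_of_all _ fun z => by positivity)).2 ?_⟩
    simp_rw [heq]
    exact hle.trans_lt hfin.lt_top
  · rw [integral_eq_lintegral_of_nonneg_ae (ae_of_all _ fun z => by positivity) hmeas]
    simp_rw [heq]
    refine (ENNReal.toReal_mono hfin hle).trans_eq ?_
    rw [ENNReal.toReal_mul, ENNReal.toReal_ofReal (by positivity)]

/-- All bounds reduce to w = v - u, which vanishes off Ω. -/
theorem energyClass (S : Setting s p Λ K Ω Ω') (hg : MemTailSpace s p g) :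
    EnergyClass p (kernelMeasure K) ((kernelMeasure K).restrict (Ω' ×ˢ Ω'))
      (pairDiff '' obstacleClass s p g h Ω Ω') := by
  have hgm := hg.aestronglyMeasurable
  have hp0 : 0 < p := by linarith [S.one_lt_p]
  have hsub : ∀ (u v : E n → ℝ) z, pairDiff v z - pairDiff u z = pairDiff (v - u) z :=
    fun u v z => by rw [pairDiff_sub]; rfl
  refine ⟨Measure.restrict_le_self, ?_, ?_, ?_, ?_, ?_, ?_, ?_, ?_⟩
  · rintro _ ⟨u, hu, rfl⟩ _ ⟨v, hv, rfl⟩ t ht0 ht1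
    refine ⟨_, S.convex_mem hgm hu hv ht0 ht1, ?_⟩
    ext z; simp only [pairDiff]; ring
  · rintro _ ⟨u, hu, rfl⟩
    exact (pairDiff_aestronglyMeasurable (S.aestronglyMeasurable_of_mem hgm hu)).mono_ac
      kernelMeasure_absolutelyContinuous
  · rintro _ ⟨u, hu, rfl⟩
    exact ((S.memW_iff (S.aestronglyMeasurable_of_mem hgm hu)).1 hu.1).2
  · rintro _ ⟨u, hu, rfl⟩ _ ⟨v, hv, rfl⟩
    simp only [hsub]
    exact S.integrable_rpow_pairDiff ((S.aestronglyMeasurable_of_mem hgm hv).sub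
      (S.aestronglyMeasurable_of_mem hgm hu)) (S.ae_sub_eq_zero hu hv)
      (S.memLp_pairDiff_sub hgm hu hv)
  · obtain ⟨C, hC, H⟩ := S.exists_lintegral_rpow_le
    refine ⟨C.toReal, ?_⟩
    rintro _ ⟨u, hu, rfl⟩ _ ⟨v, hv, rfl⟩
    simp only [hsub]
    have hwm := (S.aestronglyMeasurable_of_mem hgm hv).sub (S.aestronglyMeasurable_of_mem hgm hu)
    have hi := S.integrable_rpow_pairDiff hwm (S.ae_sub_eq_zero hu hv)
      (S.memLp_pairDiff_sub hgm hu hv)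
    have hle := H _ hwm (S.ae_sub_eq_zero hu hv)
    rw [← ofReal_integral_abs_rpow hp0.le hi, ← ofReal_integral_abs_rpow hp0.le hi.restrict] at hle
    have h0 : 0 ≤ ∫ z in Ω' ×ˢ Ω', |pairDiff (v - u) z| ^ p ∂(kernelMeasure K) :=
      integral_nonneg fun z => by positivity
    have := ENNReal.toReal_mono (ENNReal.mul_ne_top hC ENNReal.ofReal_ne_top) hle
    rwa [ENNReal.toReal_mul, ENNReal.toReal_ofReal h0,
      ENNReal.toReal_ofReal (integral_nonneg fun z => by positivity)] at this
  · rintro _ ⟨u, hu, rfl⟩ _ ⟨v, hv, rfl⟩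
    obtain ⟨C, H⟩ := S.exists_dual hg hu
    simp only [hsub]
    exact (H _ ((S.aestronglyMeasurable_of_mem hgm hv).sub
      (S.aestronglyMeasurable_of_mem hgm hu)) (S.ae_sub_eq_zero hu hv)
      (S.memLp_pairDiff_sub hgm hu hv)).1
  · rintro _ ⟨u, hu, rfl⟩
    obtain ⟨C, H⟩ := S.exists_dual hg hu
    refine ⟨C, ?_⟩
    rintro _ ⟨v, hv, rfl⟩
    simp only [hsub]
    exact (H _ ((S.aestronglyMeasurable_of_mem hgm hv).sub
      (S.aestronglyMeasurable_of_mem hgm hu)) (S.ae_sub_eq_zero hu hv)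
      (S.memLp_pairDiff_sub hgm hu hv)).2
  · intro f hf hcau
    choose u hu huf using hf
    simp only [← huf] at hcau ⊢
    obtain ⟨v, hv, hlim⟩ := S.obstacleClass_complete hgm hu hcau
    exact ⟨_, ⟨v, hv, rfl⟩, hlim⟩

/-- Two elements of the obstacle class with the same increments agree almost everywhere. -/
theorem ae_eq_of_pairDiff_ae_eq (S : Setting s p Λ K Ω Ω') (hg : AEStronglyMeasurable g volume)
    {u v : E n → ℝ} (hu : u ∈ obstacleClass s p g h Ω Ω')
    (hv : v ∈ obstacleClass s p g h Ω Ω') (huv : pairDiff u =ᵐ[kernelMeasure K] pairDiff v) :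
    u =ᵐ[volume] v := by
  have hp0 : 0 < p := by linarith [S.one_lt_p]
  obtain ⟨C, hC, hP⟩ := S.exists_eLpNorm_le
  have hm := (S.aestronglyMeasurable_of_mem hg hu).sub (S.aestronglyMeasurable_of_mem hg hv)
  have hle := hP _ hm (S.ae_sub_eq_zero hv hu)
  have h0 : pairDiff (u - v) =ᵐ[(kernelMeasure K).restrict (Ω' ×ˢ Ω')] 0 := by
    filter_upwards [ae_restrict_of_ae huv] with z hz
    rw [pairDiff_sub, Pi.sub_apply, hz, sub_self]; rfl
  rw [eLpNorm_congr_ae h0, eLpNorm_zero, mul_zero, nonpos_iff_eq_zero,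
    eLpNorm_eq_zero_iff hm (by simpa using hp0)] at hle
  filter_upwards [hle] with x hx
  exact sub_eq_zero.1 hx

end Setting

end

end FracObstacle

end
noncomputable section

namespace FracObstacle

open Filter Topology

/-! ### The weak form, test functions and the main theorem -/

section

variable {n : ℕ} {s p Λ : ℝ} {K : E n → E n → ℝ} {Ω Ω' : Set (E n)} {g : E n → ℝ}
  {h : E n → EReal}

theorem weakIntegrand_eq (K : E n → E n → ℝ) (u v : E n → ℝ) (z : E n × E n) :
    weakIntegrand p K u v z = oddPow p (pairDiff u z) * pairDiff v z * K z.1 z.2 := rfl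

theorem weakIntegrand_swap (hK : IsKernel s p Λ K) (u v : E n → ℝ) (z : E n × E n) :
    weakIntegrand p K u v z.swap = weakIntegrand p K u v z := by
  rw [weakIntegrand_eq, weakIntegrand_eq]
  have h1 : ∀ f : E n → ℝ, pairDiff f z.swap = -pairDiff f z := fun f => by
    simp [pairDiff]
  rw [h1, h1, oddPow_neg, Prod.fst_swap, Prod.snd_swap, hK.symm z.2 z.1]
  ring

theorem integral_weakIntegrand (hK : IsKernel s p Λ K) (u v : E n → ℝ) :
    ∫ z, weakIntegrand p K u v z = ∫ z, oddPow p (pairDiff u z) * pairDiff v z ∂(kernelMeasure K) := by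
  rw [kernelMeasure, integral_withDensity_eq_integral_toReal_smul₀ hK.aemeasurable.ennreal_ofReal
    (ae_of_all _ fun z => ENNReal.ofReal_lt_top)]
  refine integral_congr_ae (ae_of_all _ fun z => ?_)
  simp only [weakIntegrand_eq, smul_eq_mul]
  rw [ENNReal.toReal_ofReal (hK.nonneg _ _), mul_comm]

theorem integrable_weakIntegrand_iff (hK : IsKernel s p Λ K) (u v : E n → ℝ) :
    Integrable (weakIntegrand p K u v) ↔
      Integrable (fun z => oddPow p (pairDiff u z) * pairDiff v z) (kernelMeasure K) := by
  have := integrable_withDensity_iff_integrable_smul₀ (μ := (volume : Measure (E n × E n)))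
    (f := fun z : E n × E n => (K z.1 z.2).toNNReal) hK.aemeasurable.real_toNNReal
    (g := fun z => oddPow p (pairDiff u z) * pairDiff v z)
  refine Iff.trans (iff_of_eq ?_) this.symm
  congr 1
  ext z
  rw [weakIntegrand_eq, NNReal.smul_def, Real.coe_toNNReal _ (hK.nonneg _ _), smul_eq_mul, mul_comm]

namespace Setting

theorem integrable_weakIntegrand (S : Setting s p Λ K Ω Ω') (hg : MemTailSpace s p g)
    {u : E n → ℝ} (hu : u ∈ obstacleClass s p g h Ω Ω') {w : E n → ℝ}
    (hwm : AEStronglyMeasurable w volume) (hw : ∀ᵐ x, x ∉ Ω → w x = 0)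
    (hwν : MemLp (pairDiff w) (ENNReal.ofReal p) ((kernelMeasure K).restrict (Ω' ×ˢ Ω'))) :
    Integrable (weakIntegrand p K u w) := by
  rw [integrable_weakIntegrand_iff S.kernel]
  obtain ⟨C, H⟩ := S.exists_dual hg hu
  have hac := kernelMeasure_absolutelyContinuous (K := K)
  have hum' := ((pairDiff_aestronglyMeasurable (S.aestronglyMeasurable_of_mem
    hg.aestronglyMeasurable hu)).mono_ac hac).aemeasurable
  have hwm' := ((pairDiff_aestronglyMeasurable hwm).mono_ac hac).aemeasurable
  refine (H w hwm hw hwν).1.mono'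
    (((measurable_oddPow p).comp_aemeasurable hum').mul hwm').aestronglyMeasurable
    (ae_of_all _ fun z => ?_)
  rw [Real.norm_eq_abs, abs_mul, abs_oddPow S.one_lt_p]

/-- For increments that vanish outside `Ω`, the form `𝒜` is the full weak form. -/
theorem A_eq_integral (S : Setting s p Λ K Ω Ω') {u w : E n → ℝ}
    (hug : ∀ᵐ x, x ∉ Ω → u x = g x) (hw : ∀ᵐ x, x ∉ Ω → w x = 0)
    (hint : Integrable (weakIntegrand p K u w)) :
    A p K g Ω Ω' u w = ∫ z, weakIntegrand p K u w z := by
  have hΩ := S.isOpen.measurableSet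
  have hΩ' := S.isOpen'.measurableSet
  have hfar : ∫ z in Ω ×ˢ Ω'ᶜ, L p (u z.1) (g z.2) * w z.1 * K z.1 z.2 =
      ∫ z in Ω ×ˢ Ω'ᶜ, weakIntegrand p K u w z := by
    refine integral_congr_ae ?_
    filter_upwards [ae_restrict_mem (hΩ.prod hΩ'.compl), ae_restrict_of_ae (ae_fst_and_snd hug),
      ae_restrict_of_ae (ae_fst_and_snd hw)] with z hz h1 h2
    have hz2 : z.2 ∉ Ω := fun h' => hz.2 (S.subset h')
    rw [weakIntegrand, h1.2 hz2, h2.2 hz2, sub_zero]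
  have hswap : ∫ z in Ω'ᶜ ×ˢ Ω, weakIntegrand p K u w z =
      ∫ z in Ω ×ˢ Ω'ᶜ, weakIntegrand p K u w z := by
    have hmp : MeasurePreserving (Prod.swap : E n × E n → E n × E n) volume volume :=
      Measure.measurePreserving_swap
    have := hmp.setIntegral_preimage_emb MeasurableEquiv.prodComm.measurableEmbedding
      (weakIntegrand p K u w) (Ω ×ˢ Ω'ᶜ)
    rw [← this, Set.preimage_swap_prod]
    simp_rw [weakIntegrand_swap S.kernel]
  have hdis : Disjoint (Ω ×ˢ Ω'ᶜ) (Ω'ᶜ ×ˢ Ω) := by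
    rw [Set.disjoint_left]
    rintro z hz hz'
    exact hz'.1 (S.subset hz.1)
  have hdis' : Disjoint (Ω' ×ˢ Ω') ((Ω ×ˢ Ω'ᶜ) ∪ (Ω'ᶜ ×ˢ Ω)) := by
    rw [Set.disjoint_left]
    rintro z hz (hz' | hz')
    exacts [hz'.2 hz.2, hz'.1 hz.1]
  -- Every pair left over has both points outside Ω, where w vanishes.
  have hzero : ∀ᵐ z : E n × E n, z ∉ (Ω' ×ˢ Ω') ∪ ((Ω ×ˢ Ω'ᶜ) ∪ (Ω'ᶜ ×ˢ Ω)) →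
      weakIntegrand p K u w z = 0 := by
    filter_upwards [ae_fst_and_snd hw] with z hz hz'
    have hx : z.1 ∈ Ω → z.1 ∈ Ω' := fun h' => S.subset h'
    have hy : z.2 ∈ Ω → z.2 ∈ Ω' := fun h' => S.subset h'
    simp only [Set.mem_union, Set.mem_prod, Set.mem_compl_iff] at hz'
    have h1 : z.1 ∉ Ω := by tauto
    have h2 : z.2 ∉ Ω := by tauto
    rw [weakIntegrand, hz.1 h1, hz.2 h2]
    simp
  rw [← setIntegral_eq_integral_of_ae_compl_eq_zero hzero,
    setIntegral_union hdis' ((hΩ.prod hΩ'.compl).union (hΩ'.compl.prod hΩ)) hint.integrableOn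
      hint.integrableOn,
    setIntegral_union hdis (hΩ'.compl.prod hΩ) hint.integrableOn hint.integrableOn, hswap,
    A, A₂, hfar, two_mul]
  rfl

end Setting

/-! ### Test functions and membership in the tail space. -/

theorem lintegral_norm_rpow_ball_lt_top (hn : 1 ≤ n) {q R : ℝ} (hq : -(n : ℝ) < q) (hR : 0 < R) :
    ∫⁻ x in Metric.ball (0 : E n) R, ENNReal.ofReal (‖x‖ ^ q) < ⊤ := by
  have : Nonempty (Fin n) := ⟨⟨0, hn⟩⟩
  have hi : Integrable (fun x : E n => (Set.Iio R).indicator (fun r : ℝ => r ^ q) ‖x‖) volume := by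
    rw [integrable_fun_norm_addHaar volume (f := (Set.Iio R).indicator (fun r : ℝ => r ^ q))]
    have h1 : IntegrableOn (fun r : ℝ => r ^ ((n : ℝ) - 1 + q)) (Set.Ioo 0 R) volume :=
      (intervalIntegral.integrableOn_Ioo_rpow_iff hR).2 (by linarith)
    have h2 : IntegrableOn ((Set.Iio R).indicator fun r : ℝ => r ^ ((n : ℝ) - 1 + q))
        (Set.Ioi 0) volume := by
      rw [integrableOn_indicator_iff measurableSet_Iio]
      rwa [Set.inter_comm, Set.Ioi_inter_Iio]
    refine h2.congr_fun (fun r hr => ?_) measurableSet_Ioi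
    have hr0 : (0 : ℝ) < r := hr
    by_cases hrR : r < R
    · simp only [Set.indicator, Set.mem_Iio, hrR, if_true, smul_eq_mul, finrank_euclideanSpace,
        Fintype.card_fin]
      rw [Real.rpow_add hr0, ← Real.rpow_natCast, Nat.cast_sub hn, Nat.cast_one]
    · simp [Set.indicator, hrR]
  refine lt_of_le_of_lt (le_of_eq ?_) hi.lintegral_lt_top
  rw [← lintegral_indicator Metric.isOpen_ball.measurableSet]
  refine lintegral_congr fun x => ?_
  by_cases hx : ‖x‖ < R
  · simp [Set.indicator, hx]
  · simp [Set.indicator, hx]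

/-- A Lipschitz bound reduces the Gagliardo integrand to |x - y|^(p-n-sp), whose exponent exceeds -n
because s < 1. -/
theorem memW_of_contDiff (S : Setting s p Λ K Ω Ω') {η : E n → ℝ} (hη : ContDiff ℝ ∞ η)
    (hc : HasCompactSupport η) : MemW s p Ω' η := by
  have hp := S.one_lt_p
  have hp0 : 0 < p := by linarith
  refine ⟨(hη.continuous.memLp_of_hasCompactSupport hc).restrict _, ?_⟩
  obtain ⟨C, hC⟩ := hη.lipschitzWith_of_hasCompactSupport hc (by simp)
  obtain ⟨R, hR0, hR⟩ := S.isBounded'.exists_pos_norm_le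
  set q := p - ((n : ℝ) + s * p) with hq
  have hqn : -(n : ℝ) < q := by
    have : s * p < p := by nlinarith [S.s_lt_one]
    rw [hq]; linarith
  have hJ := lintegral_norm_rpow_ball_lt_top S.dim_pos hqn (by linarith : 0 < 2 * R + 1)
  set G : E n → ℝ≥0∞ := (Metric.ball (0 : E n) (2 * R + 1)).indicator
    fun x => ENNReal.ofReal (‖x‖ ^ q)
  have hGm : Measurable G :=
    Measurable.indicator (by fun_prop) Metric.isOpen_ball.measurableSet
  have hpt : ∀ z ∈ Ω' ×ˢ Ω', ENNReal.ofReal (|η z.1 - η z.2| ^ p /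
      ‖z.1 - z.2‖ ^ ((n : ℝ) + s * p)) ≤ ENNReal.ofReal ((C : ℝ) ^ p) * G (z.1 - z.2) := by
    intro z hz
    have hmem : z.1 - z.2 ∈ Metric.ball (0 : E n) (2 * R + 1) := by
      rw [mem_ball_zero_iff]
      have h1 := hR _ hz.1
      have h2 := hR _ hz.2
      linarith [norm_sub_le z.1 z.2]
    simp only [G, Set.indicator_of_mem hmem]
    rw [← ENNReal.ofReal_mul (by positivity)]
    refine ENNReal.ofReal_le_ofReal ?_
    rcases (norm_nonneg (z.1 - z.2)).eq_or_lt with h0 | hpos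
    · have : z.1 = z.2 := sub_eq_zero.1 (norm_eq_zero.1 h0.symm)
      rw [this, sub_self, abs_zero, Real.zero_rpow hp0.ne', zero_div]
      positivity
    · rw [hq, Real.rpow_sub hpos, ← mul_div_assoc]
      gcongr
      rw [← Real.mul_rpow C.coe_nonneg hpos.le]
      refine Real.rpow_le_rpow (abs_nonneg _) ?_ hp0.le
      have := hC.dist_le_mul z.1 z.2
      rwa [Real.dist_eq, dist_eq_norm] at this
  have hm := S.isOpen'.measurableSet
  have hvol : (volume : Measure (E n × E n)).restrict (Ω' ×ˢ Ω') =
      (volume.restrict Ω').prod (volume.restrict Ω') := by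
    rw [Measure.prod_restrict]; rfl
  calc gagliardoEnergy s p Ω' η
      ≤ ∫⁻ z in Ω' ×ˢ Ω', ENNReal.ofReal ((C : ℝ) ^ p) * G (z.1 - z.2) :=
        setLIntegral_mono' (hm.prod hm) hpt
    _ = ∫⁻ x in Ω', ∫⁻ y in Ω', ENNReal.ofReal ((C : ℝ) ^ p) * G (x - y) := by
        rw [hvol, lintegral_prod]
        exact ((hGm.comp (measurable_fst.sub measurable_snd)).const_mul _).aemeasurable
    _ ≤ ∫⁻ _ in Ω', ENNReal.ofReal ((C : ℝ) ^ p) * ∫⁻ y, G y := by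
        refine lintegral_mono fun x => ?_
        rw [lintegral_const_mul' _ _ ENNReal.ofReal_ne_top, ← lintegral_sub_left_eq_self G x]
        gcongr
        exact Measure.restrict_le_self
    _ < ⊤ := by
        rw [lintegral_const, Measure.restrict_apply_univ,
          lintegral_indicator Metric.isOpen_ball.measurableSet]
        exact ENNReal.mul_lt_top (ENNReal.mul_lt_top ENNReal.ofReal_lt_top hJ)
          S.isBounded'.measure_lt_top

theorem MemW.mono {D : Set (E n)} {u : E n → ℝ} (hu : MemW s p Ω' u) (hD : D ⊆ Ω') :
    MemW s p D u :=
  ⟨hu.1.mono_measure (Measure.restrict_mono hD le_rfl),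
    (lintegral_mono_set (Set.prod_mono hD hD)).trans_lt hu.2⟩

/-- Off Ω the function is g; on the bounded set Ω it is in L^p, hence in L^(p-1), and outside B_r(z)
the tail weight is at most r^(-n-sp). -/
theorem Setting.memTailSpace_of_mem (S : Setting s p Λ K Ω Ω') (hg : MemTailSpace s p g)
    {u : E n → ℝ} (hu : u ∈ obstacleClass s p g h Ω Ω') : MemTailSpace s p u := by
  have hp := S.one_lt_p
  have hp1 : 0 < p - 1 := by linarith
  have hΩ := S.isOpen.measurableSet
  have hum := S.aestronglyMeasurable_of_mem hg.aestronglyMeasurable hu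
  have hug := (S.mem_obstacleClass_iff.1 hu).2.2
  have hfin : IsFiniteMeasure (volume.restrict Ω) :=
    ⟨by simpa using (S.isBounded'.subset S.subset).measure_lt_top⟩
  have huΩ : ∫⁻ x in Ω, ‖u x‖ₑ ^ (p - 1) < ⊤ :=
    lintegral_enorm_rpow_lt_top_of_memLp hp1 ((hu.1.1.mono_measure
      (Measure.restrict_mono S.subset le_rfl)).mono_exponent
        (ENNReal.ofReal_le_ofReal (by linarith)))
  have hsplit : ∀ (B : Set (E n)) (F : E n → ℝ → ℝ≥0∞), MeasurableSet B →
      ∫⁻ x in B, F x (u x) ≤ (∫⁻ x in B ∩ Ω, F x (u x)) + ∫⁻ x in B, F x (g x) := by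
    intro B F hB
    have h1 := lintegral_union_le (μ := volume) (fun x => F x (u x)) (B ∩ Ω) (B \ Ω)
    rw [Set.inter_union_sdiff] at h1
    refine h1.trans (add_le_add le_rfl ?_)
    refine le_trans (le_of_eq (lintegral_congr_ae ?_)) (lintegral_mono_set Set.sdiff_subset)
    filter_upwards [ae_restrict_mem (hB.diff hΩ), ae_restrict_of_ae hug] with x hx h1
    rw [h1 hx.2]
  refine ⟨fun C hC => ?_, fun z r hr => ?_⟩
  · rw [memLp_iff_lintegral_enorm_rpow_lt_top hp1 hum.restrict]
    refine (hsplit C (fun _ t => ‖t‖ₑ ^ (p - 1)) hC.isClosed.measurableSet).trans_lt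
      (ENNReal.add_lt_top.2 ⟨(lintegral_mono_set Set.inter_subset_right).trans_lt huΩ,
        lintegral_enorm_rpow_lt_top_of_memLp hp1 (hg.1 C hC)⟩)
  · rw [tail, ENNReal.rpow_lt_top_iff_of_pos (one_div_pos.2 hp1)]
    refine ENNReal.mul_lt_top ENNReal.ofReal_lt_top ?_
    have hB := (Metric.isOpen_ball (x := z) (ε := r)).measurableSet.compl
    refine (hsplit _ (fun x t => ENNReal.ofReal (|t| ^ (p - 1) * ‖x - z‖ ^ (-(n : ℝ) - s * p)))
      hB).trans_lt (ENNReal.add_lt_top.2 ⟨?_, lintegral_tail_lt_top hp hg z hr⟩)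
    calc ∫⁻ x in (Metric.ball z r)ᶜ ∩ Ω,
          ENNReal.ofReal (|u x| ^ (p - 1) * ‖x - z‖ ^ (-(n : ℝ) - s * p))
        ≤ ∫⁻ x in (Metric.ball z r)ᶜ ∩ Ω,
          ENNReal.ofReal (r ^ (-(n : ℝ) - s * p)) * ‖u x‖ₑ ^ (p - 1) := by
          refine setLIntegral_mono' (hB.inter hΩ) fun x hx => ?_
          have hxr : r ≤ ‖x - z‖ := by
            simpa [Metric.mem_ball, dist_eq_norm] using hx.1
          rw [← ofReal_abs_rpow hp1.le, ← ENNReal.ofReal_mul (by positivity), mul_comm]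
          refine ENNReal.ofReal_le_ofReal (mul_le_mul_of_nonneg_right ?_ (by positivity))
          exact Real.rpow_le_rpow_of_nonpos hr hxr (by linarith [S.exponent_pos])
      _ ≤ ENNReal.ofReal (r ^ (-(n : ℝ) - s * p)) * ∫⁻ x in Ω, ‖u x‖ₑ ^ (p - 1) := by
          rw [lintegral_const_mul' _ _ ENNReal.ofReal_ne_top]
          gcongr
          exact Set.inter_subset_right
      _ < ⊤ := ENNReal.mul_lt_top ENNReal.ofReal_lt_top huΩ

namespace Setting

theorem A_sub_eq (S : Setting s p Λ K Ω Ω') (hg : MemTailSpace s p g) {u v : E n → ℝ}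
    (hu : u ∈ obstacleClass s p g h Ω Ω') (hv : v ∈ obstacleClass s p g h Ω Ω') :
    A p K g Ω Ω' u (v - u) =
      ∫ z, oddPow p (pairDiff u z) * (pairDiff v z - pairDiff u z) ∂(kernelMeasure K) := by
  have hgm := hg.aestronglyMeasurable
  rw [S.A_eq_integral (S.mem_obstacleClass_iff.1 hu).2.2 (S.ae_sub_eq_zero hu hv)
    (S.integrable_weakIntegrand hg hu ((S.aestronglyMeasurable_of_mem hgm hv).sub
      (S.aestronglyMeasurable_of_mem hgm hu)) (S.ae_sub_eq_zero hu hv)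
      (S.memLp_pairDiff_sub hgm hu hv)), integral_weakIntegrand S.kernel, pairDiff_sub]
  rfl

theorem exists_isObstacleSolution (S : Setting s p Λ K Ω Ω') (hg : MemTailSpace s p g)
    (hne : (obstacleClass s p g h Ω Ω').Nonempty) :
    ∃ u, IsObstacleSolution s p K g h Ω Ω' u := by
  obtain ⟨_, ⟨u, hu, rfl⟩, H⟩ :=
    (S.energyClass (h := h) hg).exists_variational S.one_lt_p (hne.image _)
  exact ⟨u, hu, fun v hv => (S.A_sub_eq hg hu hv).symm ▸ H _ ⟨v, hv, rfl⟩⟩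

theorem isObstacleSolution_unique (S : Setting s p Λ K Ω Ω') (hg : MemTailSpace s p g)
    {u v : E n → ℝ} (hu : IsObstacleSolution s p K g h Ω Ω' u)
    (hv : IsObstacleSolution s p K g h Ω Ω' v) : v =ᵐ[volume] u :=
  S.ae_eq_of_pairDiff_ae_eq hg.aestronglyMeasurable hv.1 hu.1
    ((S.energyClass (h := h) hg).ae_eq_of_variational S.one_lt_p ⟨v, hv.1, rfl⟩ ⟨u, hu.1, rfl⟩
      (S.A_sub_eq hg hv.1 hu.1 ▸ hv.2 u hu.1) (S.A_sub_eq hg hu.1 hv.1 ▸ hu.2 v hv.1))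

theorem isWeakSupersolution (S : Setting s p Λ K Ω Ω') (hg : MemTailSpace s p g) {u : E n → ℝ}
    (hu : IsObstacleSolution s p K g h Ω Ω' u) : IsWeakSupersolution s p K Ω u := by
  have hgm := hg.aestronglyMeasurable
  refine ⟨fun D _ hD => hu.1.1.mono (subset_closure.trans (hD.2.trans S.subset)),
    S.memTailSpace_of_mem hg hu.1, fun η hη hc hsupp hη0 => ?_⟩
  have hηz : ∀ x, x ∉ Ω → η x = 0 := fun x hx =>
    image_eq_zero_of_notMem_tsupport fun h' => hx (hsupp h')
  have hum := S.aestronglyMeasurable_of_mem hgm hu.1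
  have hηm : AEStronglyMeasurable η volume := hη.continuous.aestronglyMeasurable
  have hηW := (S.memW_iff hηm).1 (memW_of_contDiff S hη hc)
  have huW := (S.memW_iff hum).1 hu.1.1
  have hint := S.integrable_weakIntegrand hg hu.1 hηm (ae_of_all _ hηz) hηW.2
  refine ⟨hint, ?_⟩
  rw [← S.A_eq_integral (S.mem_obstacleClass_iff.1 hu.1).2.2 (ae_of_all _ hηz) hint]
  -- Adding η ≥ 0 preserves the obstacle condition, and η = 0 off Ω preserves the boundary values.
  have hmem : u + η ∈ obstacleClass s p g h Ω Ω' := by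
    obtain ⟨-, h1, h2⟩ := S.mem_obstacleClass_iff.1 hu.1
    refine S.mem_obstacleClass_iff.2 ⟨(S.memW_iff (hum.add hηm)).2
      ⟨huW.1.add hηW.1, ?_⟩, ?_, ?_⟩
    · convert huW.2.add hηW.2 using 1
      ext z; simp only [pairDiff, Pi.add_apply]; ring
    · filter_upwards [h1] with x hx hxΩ
      exact (hx hxΩ).trans (EReal.coe_le_coe_iff.2 (le_add_of_nonneg_right (hη0 x)))
    · filter_upwards [h2] with x hx hxΩ
      rw [Pi.add_apply, hx hxΩ, hηz x hxΩ, add_zero]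
  have := hu.2 _ hmem
  rwa [add_sub_cancel_left] at this

end Setting

end

end FracObstacle

end

theorem theorem3p3 {n : ℕ} (hn : 1 ≤ n) {s p Λ : ℝ} (hs0 : 0 < s) (hs1 : s < 1) (hp : 1 < p)
    (hΛ : 1 ≤ Λ) (K : FracObstacle.E n → FracObstacle.E n → ℝ)
    (hK : FracObstacle.IsKernel s p Λ K)
    (Ω Ω' : Set (FracObstacle.E n)) (hΩ : IsOpen Ω) (hΩ' : IsOpen Ω')
    (hΩ'b : Bornology.IsBounded Ω') (hΩΩ' : FracObstacle.CompactlyContained Ω Ω')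
    (h : FracObstacle.E n → EReal) (hh : ∀ x, h x ≠ ⊤)
    (g : FracObstacle.E n → ℝ) (hgW : FracObstacle.MemW s p Ω' g)
    (hgT : FracObstacle.MemTailSpace s p g)
    (hne : (FracObstacle.obstacleClass s p g h Ω Ω').Nonempty) :
    (∃ u : FracObstacle.E n → ℝ, FracObstacle.IsObstacleSolution s p K g h Ω Ω' u ∧
      ∀ w : FracObstacle.E n → ℝ, FracObstacle.IsObstacleSolution s p K g h Ω Ω' w →
        w =ᵐ[MeasureTheory.volume] u) ∧
    ∀ u : FracObstacle.E n → ℝ, FracObstacle.IsObstacleSolution s p K g h Ω Ω' u →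
      FracObstacle.IsWeakSupersolution s p K Ω u := by
  have S : FracObstacle.Setting s p Λ K Ω Ω' :=
    ⟨hn, hs0, hs1, hp, hΛ, hK, hΩ, hΩ', hΩ'b, hΩΩ'⟩
  obtain ⟨u, hu⟩ := S.exists_isObstacleSolution hgT hne
  exact ⟨⟨u, hu, fun w hw => S.isObstacleSolution_unique hgT hu hw⟩,
    fun v hv => S.isWeakSupersolution hgT hv⟩
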